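/- Let $L$ be a first-order language, $T$ a complete $L$-theory, $\kappa\ge\aleph_1$ a cardinal, and $\mathfrak C$ a $\kappa$-saturated model of $T$. Let $A\subseteq\mathfrak C$ with $|A|<\kappa$, and let $\pi(\overline y)$, with $\overline y$ a finite tuple of variables, be a partial type over $A$, that is, a set of $L(A)$-formulas that is consistent (finitely satisfiable in $\mathfrak C$). Write $\pi(\mathfrak C)$ for its set of realizations in $\mathfrak C$. *Op-dimension.* An IRD-pattern of depth $m<\omega$ and length $\omega$ in $\pi$ consists of $L(\mathfrak C)$-formulas $\varphi_i(\overline y,\overline z_i)$ for $i<m$ and tuples $\overline c_{i,j}\in\mathfrak C^{|\overline z_i|}$ for $i<m$, $j<\omega$, such that for every $g:m\to\omega$ the set $$\pi(\overline y)\cup\{\varphi_i(\overline y,\overline c_{i,j}) : i<m,\ j<\omega,\ g(i)<j\}\cup\{\neg\varphi_i(\overline y,\overline c_{i,j}) : i<m,\ j<\omega,\ g(i)\ge j\}$$ is consistent. The op-dimension $\mathrm{opDim}(\pi)\in\{0,1,2,\dots,\infty\}$ is the largest $m$ such that $\pi$ has an IRD-pattern of depth $m$ and length $\omega$, and $\infty$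 if there is no largest one. *Linear-order rank.* For $m\ge 1$ let $\mathbf{LO}^{*m}$ be the class of finite sets equipped with $m$ strict linear orders $<_0,\dots,<_{m-1}$ (in the language with $m$ binary relation symbols), and let $\Gamma_m$ be its Fraïssé limit. An $\mathbf{LO}^{*m}$-configuration into $\pi$ is a function $f:\Gamma_m\to\pi(\mathfrak C)$ such that for each $i<m$ there is an $L(\mathfrak C)$-formula $\varphi_i(\overline y_0,\overline y_1)$ with $$\Gamma_m\models a<_i b\iff \mathfrak C\models\varphi_i(f(a),f(b))\qquad\text{for all }a,b\in\Gamma_m .$$ The rank $\mathrm{Rk}_{\mathbf{LO}}(\pi)$ is $0$ if there is no $\mathbf{LO}^{*1}$-configuration into $\pi$; it is $n\ge1$ if there is an $\mathbf{LO}^{*n}$-configuration but no $\mathbf{LO}^{*(n+1)}$-configuration into $\pi$; and it is $\infty$ if there is an $\mathbf{LO}^{*n}$-configuration into $\pi$ for every $n\ge1$. **Proposition.** If $T$ has NIP (every partitioned $L$-formula $\varphi(\overline x;\overline y)$ has finite VC-dimension in the models of $T$), then for every partial type $\pi$ as above $$\mathrm{Rk}_{\mathbf{LO}}(\pi)=\mathrm{opDim}(\pi).$$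 -/

import Mathlib

open FirstOrder FirstOrder.Language CategoryTheory Cardinal

universe u v w

namespace KRank



section Types

variable {L : FirstOrder.Language.{u, v}}

/-- A set of formulas is finitely satisfiable in `M`: each finite subset has a realization in `M`.
For sets of formulas with parameters in `M` this is consistency with the elementary diagram
of `M`. -/
def FinitelySatisfiable (M : Type w) [L.Structure M] {α : Type*} (p : Set (L.Formula α)) : Prop :=
  ∀ F : Set (L.Formula α), F ⊆ p → F.Finite → ∃ a : α → M, ∀ φ ∈ F, φ.Realize a

/-- The set `p(M)` of realizations of `p` in `M`. -/
def realizations (M : Type w) [L.Structure M] {α : Type*} (p : Set (L.Formula α)) :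
    Set (α → M) :=
  {a | ∀ φ ∈ p, φ.Realize a}

/-- `M` is `κ`-saturated: each consistent set of formulas in one variable over fewer than `κ`
parameters is realized in `M`. -/
def IsSaturated (L : FirstOrder.Language.{u, v}) (M : Type w) [L.Structure M] (κ : Cardinal.{w}) : Prop :=
  ∀ A : Set M, #A < κ → ∀ p : Set (L[[A]].Formula (Fin 1)),
    FinitelySatisfiable M p → (realizations M p).Nonempty

/-- The formula `φ(x; y)` shatters some `k` many tuples `a 0, …, a (k-1)` of `M`. -/
def Shatters (M : Type w) [L.Structure M] {n m : ℕ} (φ : L.Formula (Fin n ⊕ Fin m)) (k : ℕ) :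
    Prop :=
  ∃ a : Fin k → Fin n → M, ∀ s : Set (Fin k), ∃ b : Fin m → M,
    ∀ i, φ.Realize (Sum.elim (a i) b) ↔ i ∈ s

/-- `T` has NIP: each partitioned formula has finite VC-dimension in the models of `T`. -/
def IsNIP (T : L.Theory) : Prop :=
  ∀ (n m : ℕ) (φ : L.Formula (Fin n ⊕ Fin m)), ∃ k : ℕ,
    ∀ (M : Type w) [L.Structure M] [Nonempty M] [M ⊨ T], ¬ Shatters M φ k

end Types

section OpDimension

variable {L : FirstOrder.Language.{u, v}} {M : Type w} [L.Structure M]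

/-- A set of `L(A)`-formulas seen as a set of `L(M)`-formulas. -/
def liftParams {A : Set M} {α : Type*} (π : Set (L[[A]].Formula α)) : Set (L[[M]].Formula α) :=
  (L.lhomWithConstantsMap (Subtype.val : A → M)).onFormula '' π

/-- The `L(M)`-formula `φ(y, c)` obtained from `φ(y, z)` by substituting the tuple `c` for `z`. -/
def plugIn {α β : Type*} (φ : L[[M]].Formula (α ⊕ β)) (c : β → M) : L[[M]].Formula α :=
  BoundedFormula.subst φ (Sum.elim (fun i => Term.var i) (fun j => (L.con (c j)).term))

open Classical in
/-- `φ` if `P` is true, and `¬ φ` if `P` is false. -/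
noncomputable def formulaIff {α : Type*} (φ : L[[M]].Formula α) (P : Prop) : L[[M]].Formula α :=
  if P then φ else φ.not

/-- `π` has an IRD-pattern of depth `m` and length `ω`. -/
def HasIRDPattern {A : Set M} {d : ℕ} (π : Set (L[[A]].Formula (Fin d))) (m : ℕ) : Prop :=
  ∃ (k : Fin m → ℕ) (φ : ∀ i, L[[M]].Formula (Fin d ⊕ Fin (k i)))
    (c : ∀ i, ℕ → Fin (k i) → M),
    ∀ g : Fin m → ℕ, FinitelySatisfiable M
      (liftParams π ∪ {ψ | ∃ (i : Fin m) (j : ℕ), ψ = formulaIff (plugIn (φ i) (c i j)) (g i < j)})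

/-- The op-dimension of `π`: the largest depth of an IRD-pattern of length `ω` in `π`, and `∞` if
there are such patterns of arbitrarily large depth. -/
noncomputable def opDim {A : Set M} {d : ℕ} (π : Set (L[[A]].Formula (Fin d))) : ℕ∞ :=
  ⨆ (m : ℕ) (_ : HasIRDPattern π m), (m : ℕ∞)

end OpDimension

section Superposition

/-- The relational language whose signature is the disjoint union of `n` copies of the signature
of the relational language `L₀`. -/
def copies (L₀ : FirstOrder.Language.{0, 0}) (n : ℕ) : FirstOrder.Language.{0, 0} where
  Functions := fun _ => Empty
  Relations := fun k => Fin n × L₀.Relations k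

instance (L₀ : FirstOrder.Language.{0, 0}) (n : ℕ) : (copies L₀ n).IsRelational :=
  fun _ => inferInstanceAs (IsEmpty Empty)

instance (L₀ : FirstOrder.Language.{0, 0}) (n : ℕ) : Countable (Σ l, (copies L₀ n).Functions l) :=
  ⟨fun _ => 0, fun a => isEmptyElim a.2⟩

/-- The inclusion of `L₀` as the `i`-th copy. -/
def copyHom (L₀ : FirstOrder.Language.{0, 0}) [L₀.IsRelational] (n : ℕ) (i : Fin n) :
    L₀ →ᴸ copies L₀ n where
  onFunction := fun _ f => isEmptyElim f
  onRelation := fun _ R => (i, R)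

/-- The `n`-fold free superposition `K^{*n}` of `K` with itself: the finite structures each of whose
`n` reducts to a copy of `L₀` is in `K`. -/
def starPow {L₀ : FirstOrder.Language.{0, 0}} [L₀.IsRelational] (K : Set (Bundled.{0} L₀.Structure)) (n : ℕ) :
    Set (Bundled.{0} (copies L₀ n).Structure) :=
  {B | Finite B ∧ ∀ i : Fin n, (⟨B, (copyHom L₀ n i).reduct B⟩ : Bundled.{0} L₀.Structure) ∈ K}

end Superposition

section Rank

variable {L : FirstOrder.Language.{u, v}} {M : Type w} [L.Structure M]

/-- `f` is a configuration of the `L₀`-structure `Γ` into `π`: it maps `Γ` into `π(M)`, and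
each relation of `Γ` is the pullback along `f` of an `L(M)`-definable relation. -/
def IsConfiguration {L₀ : FirstOrder.Language.{0, 0}} {Γ : Type} [L₀.Structure Γ] {A : Set M} {d : ℕ}
    (π : Set (L[[A]].Formula (Fin d))) (f : Γ → Fin d → M) : Prop :=
  (∀ a, f a ∈ realizations M π) ∧
  ∀ (n : ℕ) (R : L₀.Relations n), ∃ φ : L[[M]].Formula (Fin n × Fin d),
    ∀ a : Fin n → Γ, Structure.RelMap R a ↔ φ.Realize (fun q => f (a q.1) q.2)

/-- There is a `K`-configuration into `π`, that is, a configuration of the Fraïssé limit of `K`. -/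
def HasConfiguration {L₀ : FirstOrder.Language.{0, 0}} [Countable (Σ l, L₀.Functions l)]
    (K : Set (Bundled.{0} L₀.Structure)) {A : Set M} {d : ℕ}
    (π : Set (L[[A]].Formula (Fin d))) : Prop :=
  ∃ (Γ : Type) (_ : L₀.Structure Γ) (_ : Countable Γ), IsFraisseLimit K Γ ∧
    ∃ f : Γ → Fin d → M, IsConfiguration (L₀ := L₀) π f

/-- The `K`-rank of `π`: the least `n` such that there is no `K^{*(n+1)}`-configuration into `π`,
and `∞` if there are `K^{*n}`-configurations into `π` for all `n ≥ 1`. -/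
noncomputable def rank {L₀ : FirstOrder.Language.{0, 0}} [L₀.IsRelational]
    (K : Set (Bundled.{0} L₀.Structure)) {A : Set M} {d : ℕ}
    (π : Set (L[[A]].Formula (Fin d))) : ℕ∞ :=
  ⨅ (n : ℕ) (_ : ¬ HasConfiguration (starPow K (n + 1)) π), (n : ℕ∞)

theorem rank_eq_top_iff {L₀ : FirstOrder.Language.{0, 0}} [L₀.IsRelational]
    (K : Set (Bundled.{0} L₀.Structure)) {A : Set M} {d : ℕ}
    (π : Set (L[[A]].Formula (Fin d))) :
    rank K π = ⊤ ↔ ∀ n : ℕ, 1 ≤ n → HasConfiguration (starPow K n) π := by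
  simp only [rank, iInf_eq_top, ENat.natCast_ne_top, imp_false, not_not]
  refine ⟨fun h n hn => ?_, fun h n => h _ (Nat.le_add_left 1 n)⟩
  obtain ⟨k, rfl⟩ := Nat.exists_eq_add_of_le' hn
  exact h k

theorem rank_spec {L₀ : FirstOrder.Language.{0, 0}} [L₀.IsRelational]
    (K : Set (Bundled.{0} L₀.Structure)) {A : Set M} {d : ℕ}
    (π : Set (L[[A]].Formula (Fin d))) {n : ℕ} (h : rank K π = n) :
    (1 ≤ n → HasConfiguration (starPow K n) π) ∧ ¬ HasConfiguration (starPow K (n + 1)) π := by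
  have hle : ∀ k : ℕ, ¬ HasConfiguration (starPow K (k + 1)) π → n ≤ k := fun k hk => by
    have : rank K π ≤ k := iInf₂_le k hk
    rw [h] at this
    exact_mod_cast this
  constructor
  · intro hn
    obtain ⟨k, rfl⟩ := Nat.exists_eq_add_of_le' hn
    by_contra hk
    have := hle k hk
    omega
  · intro hc
    have : ((n + 1 : ℕ) : ℕ∞) ≤ rank K π := le_iInf₂ fun k hk => by
      have h1 := hle k hk
      have h2 : n ≠ k := fun e => hk (e ▸ hc)
      exact_mod_cast (by omega : n + 1 ≤ k)
    rw [h] at this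
    have : n + 1 ≤ n := by exact_mod_cast this
    omega

end Rank

section LinearOrders

/-- The relation symbols of the language with a single, binary relation symbol. -/
inductive BinRel : ℕ → Type
  | lt : BinRel 2

/-- The language with a single binary relation symbol. -/
def binLang : FirstOrder.Language.{0, 0} where
  Functions := fun _ => Empty
  Relations := BinRel

instance : binLang.IsRelational :=
  fun _ => inferInstanceAs (IsEmpty Empty)

/-- The interpretation of the binary relation symbol. -/
def ltOn (B : Type) [binLang.Structure B] (a b : B) : Prop :=
  Structure.RelMap (L := binLang) BinRel.lt ![a, b]

/-- The class `LO` of finite strict linear orders: irreflexive, transitive, trichotomous. -/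
def LO : Set (Bundled.{0} binLang.Structure) :=
  {B | Finite B ∧ (∀ a : B, ¬ ltOn B a a) ∧
    (∀ a b c : B, ltOn B a b → ltOn B b c → ltOn B a c) ∧
    (∀ a b : B, a ≠ b → Xor (ltOn B a b) (ltOn B b a))}

end LinearOrders

end KRank

/-! For each `n ≥ 1`, a configuration of `Γ_n` exists iff an IRD-pattern of depth `n` does;
`rank_eq_opDim` turns this into the equality of ranks. From configurations to patterns it is
universality of `Γ_n`: the index set of a pattern, parameters `(i, j)` together with functions `g`,
carries `n` linear orders in which `g` precedes `(i, j)` for the `i`-th order iff `g i < j`, so it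
embeds into `Γ_n`.

The converse uses NIP. Realize the pattern by a grid over `ℕ^m` and replace it by a grid over `ℚ^m`
in which types of finite subtuples depend only on the order type in each coordinate
(`exists_indiscernible_grid`); the cuts made by the `φ_i` survive. It remains to define the order
along axis `i` by a formula in two points. Let `σ`, `τ` be sign vectors of differences that disagree
at `i`, and suppose no formula over grid points around the origin tells them apart. In the plane
with one parameter for the axes where `σ`, `τ` differ and one for the others, two opposite corners
of a rectangle can then exchange heights without changing their type over the points off the strips
spanned by the rectangle (`mem_iff_swap`). Starting from the half-plane cut out by `φ_i`, repeated
exchanges give traces that split arbitrarily many boxes with disjoint projections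
(`exists_isSplitBy_of_swap`). Indiscernibility turns these boxes into shattered sets, against NIP
(`separatesSigns`).

A Boolean combination of the separating formulas defines each order on a small cube, for pairs of
points that are equal or differ in every coordinate (`exists_order_formula`). A concrete model of
`Γ_m` embeds into this cube axis by axis. -/

namespace KRank

/-! ### Definable sets with parameters, and NIP for them. -/

section Definability

variable {L : FirstOrder.Language.{u, v}} {M : Type w} [L.Structure M]

theorem isExpansionOn_lhomWithConstantsMap_val (A : Set M) :
    (L.lhomWithConstantsMap (Subtype.val : A → M)).IsExpansionOn M := by
  have : (LHom.constantsOnMap (Subtype.val : A → M)).IsExpansionOn M :=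
    constantsOnMap_isExpansionOn rfl
  exact LHom.sumMap_isExpansionOn _ _ M

theorem isExpansionOn_lhomWithConstantsMap_univ :
    (L.lhomWithConstantsMap (fun a : M => (⟨a, trivial⟩ : (Set.univ : Set M)))).IsExpansionOn M := by
  have : (LHom.constantsOnMap
      (fun a : M => (⟨a, trivial⟩ : (Set.univ : Set M)))).IsExpansionOn M :=
    constantsOnMap_isExpansionOn rfl
  exact LHom.sumMap_isExpansionOn _ _ M

theorem realize_onFormula_val {A : Set M} {α : Type*} (φ : L[[A]].Formula α) (a : α → M) :
    ((L.lhomWithConstantsMap (Subtype.val : A → M)).onFormula φ).Realize a ↔ φ.Realize a := by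
  have := isExpansionOn_lhomWithConstantsMap_val (L := L) A
  exact LHom.realize_onFormula _ φ

theorem realize_plugIn {α β : Type*} (φ : L[[M]].Formula (α ⊕ β)) (c : β → M) (a : α → M) :
    (plugIn φ c).Realize a ↔ φ.Realize (Sum.elim a c) := by
  unfold plugIn Formula.Realize
  rw [BoundedFormula.realize_subst]
  refine iff_of_eq (congrArg (fun v => BoundedFormula.Realize φ v default) ?_)
  funext x
  rcases x with x | x
  · rfl
  · exact Term.realize_constants

theorem realize_formulaIff {α : Type*} (φ : L[[M]].Formula α) (P : Prop) (a : α → M) :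
    (formulaIff φ P).Realize a ↔ (φ.Realize a ↔ P) := by
  unfold formulaIff
  split_ifs with h <;> simp [h]

theorem definable_setOf_realize {α : Type*} (φ : L[[M]].Formula α) :
    (Set.univ : Set M).Definable L {v | φ.Realize v} := by
  have := isExpansionOn_lhomWithConstantsMap_univ (L := L) (M := M)
  refine ⟨(L.lhomWithConstantsMap
    (fun a : M => (⟨a, trivial⟩ : (Set.univ : Set M)))).onFormula φ, ?_⟩
  ext v
  exact (LHom.realize_onFormula _ φ).symm

theorem exists_formula_of_definable {α : Type*} {A : Set M} {D : Set (α → M)}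
    (hD : A.Definable L D) : ∃ φ : L[[M]].Formula α, ∀ v, φ.Realize v ↔ v ∈ D := by
  obtain ⟨φ, rfl⟩ := hD
  exact ⟨(L.lhomWithConstantsMap (Subtype.val : A → M)).onFormula φ,
    fun v => realize_onFormula_val φ v⟩

/-- In a model of a theory with NIP, each relation definable with parameters has finite
VC-dimension. -/
theorem IsNIP.exists_not_shattered {T : L.Theory} (hT : IsNIP.{u, v, w} T) [Nonempty M] [M ⊨ T]
    {n m : ℕ} {D : Set (Fin n ⊕ Fin m → M)} (hD : (Set.univ : Set M).Definable L D) :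
    ∃ k : ℕ, ¬ ∃ a : Fin k → Fin n → M, ∀ s : Set (Fin k), ∃ b : Fin m → M,
      ∀ i, Sum.elim (a i) b ∈ D ↔ i ∈ s := by
  obtain ⟨A, -, hA⟩ := Set.definable_iff_finitely_definable.1 hD
  obtain ⟨φ, rfl⟩ := Set.definable_iff_exists_formula_sum.1 hA
  let e : (A : Set M) ≃ Fin A.card := A.equivFin
  -- The finitely many parameters become extra variables on the `z` side, so the bound for an
  -- `L`-formula applies.
  let r : (A : Set M) ⊕ (Fin n ⊕ Fin m) → Fin n ⊕ Fin (m + A.card) :=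
    Sum.elim (fun x => Sum.inr (Fin.natAdd m (e x)))
      (Sum.elim Sum.inl fun j => Sum.inr (Fin.castAdd A.card j))
  obtain ⟨k, hk⟩ := hT n (m + A.card) (φ.relabel r)
  refine ⟨k, fun ⟨a, ha⟩ => hk M ⟨a, fun s => ?_⟩⟩
  obtain ⟨b, hb⟩ := ha s
  refine ⟨Fin.append b fun j => (e.symm j : M), fun i => ?_⟩
  rw [← hb i, Formula.realize_relabel]
  refine iff_of_eq (congrArg φ.Realize ?_)
  funext x
  rcases x with x | x | x <;> simp [r]

theorem definable_eq_const {α : Type*} {B : Set M} (i : α) {c : M} (hc : c ∈ B) :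
    B.Definable L {x : α → M | x i = c} :=
  ⟨(Term.var i).equal (L.con (⟨c, hc⟩ : B)).term, by ext; simp⟩

/-- A definable set depends on finitely many coordinates. -/
theorem exists_definable_restrict {α : Type*} {B : Set M} {D : Set (α → M)}
    (hD : B.Definable L D) : ∃ (S : Finset α) (D' : Set (S → M)), B.Definable L D' ∧
      ∀ x : α → M, x ∈ D ↔ (fun i : S => x i) ∈ D' := by
  classical
  obtain ⟨φ, rfl⟩ := hD
  refine ⟨φ.freeVarFinset, {v | Formula.Realize (φ.restrictFreeVar id) v}, ⟨_, rfl⟩, fun x => ?_⟩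
  exact (BoundedFormula.realize_restrictFreeVar (φ := φ) (f := id) x fun a => rfl).symm

/-- Sets `{w | ∃ z, ∀ j, (D (w j) z ↔ ε j)}` are definable. -/
theorem definable_exists_pattern {B : Set M} {d k n : ℕ} {D : Set (Fin d ⊕ Fin k → M)}
    (hD : B.Definable L D) (ε : Fin n → Prop) :
    B.Definable L {w : Fin n × Fin d → M | ∃ z : Fin k → M,
      ∀ j, Sum.elim (fun q => w (j, q)) z ∈ D ↔ ε j} := by
  classical
  let f : Fin n → Fin d ⊕ Fin k → (Fin n × Fin d) ⊕ Fin k := fun j =>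
    Sum.map (fun q => (j, q)) id
  have h : ∀ j, B.Definable L {x : (Fin n × Fin d) ⊕ Fin k → M | x ∘ f j ∈ D ↔ ε j} := by
    intro j
    by_cases hj : ε j
    · simp only [hj, iff_true]
      exact hD.preimage_comp (f j)
    · simp only [hj, iff_false]
      exact (hD.preimage_comp (f j)).compl
  convert! (Set.definable_iInter_of_finite h).exists_of_finite using 1
  ext w
  simp only [Set.mem_ofPred_eq, Set.mem_iInter]
  refine exists_congr fun z => forall_congr' fun j => ?_
  have : Sum.elim w z ∘ f j = Sum.elim (fun q => w (j, q)) z := by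
    funext x; rcases x with x | x <;> rfl
  rw [this]

end Definability

/-! ### From saturation in one variable to countably many variables. -/

section Saturation

variable {L : FirstOrder.Language.{u, v}} {M : Type w} [L.Structure M]

/-- Uncountability of `κ` enters here: countably many parameters may be added to a small set. -/
theorem mk_union_countable_lt {κ : Cardinal.{w}} (hκ : ℵ_ 1 ≤ κ) {B C : Set M} (hB : #B < κ)
    (hC : C.Countable) : #(B ∪ C : Set M) < κ := by
  have h0 : ℵ₀ < κ := lt_of_lt_of_le aleph0_lt_aleph_one hκ
  exact (mk_union_le B C).trans_lt (add_lt_of_lt h0.le hB (hC.le_aleph0.trans_lt h0))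

/-- With the earlier coordinates fixed, each finite subfamily constrains the `n`-th coordinate
through a projection definable over `B` and `a 0, …, a (n-1)`. Finitely many such projections have a
common point, supplied by the union of the subfamilies, so one-variable saturation yields `c`. -/
theorem IsSaturated.exists_next {κ : Cardinal.{w}} (hκ : ℵ_ 1 ≤ κ) (hM : IsSaturated L M κ)
    {B : Set M} (hB : #B < κ) {𝓢 : Set (Set (ℕ → M))} (hd : ∀ D ∈ 𝓢, B.Definable L D)
    (n : ℕ) (a : ℕ → M)
    (ha : ∀ T ⊆ 𝓢, T.Finite → ∃ x ∈ ⋂₀ T, ∀ i < n, x i = a i) :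
    ∃ c : M, ∀ T ⊆ 𝓢, T.Finite → ∃ x ∈ ⋂₀ T, (∀ i < n, x i = a i) ∧ x n = c := by
  classical
  let C : Set M := B ∪ a '' Set.Iio n
  have hC : #C < κ :=
    mk_union_countable_lt hκ hB ((Set.finite_Iio n).image a).countable
  let P : Set (Set (ℕ → M)) → Set (Fin 1 → M) := fun T =>
    {y | ∃ x ∈ ⋂₀ T, (∀ i < n, x i = a i) ∧ x n = y 0}
  have hP : ∀ T ⊆ 𝓢, T.Finite → C.Definable L (P T) := by
    intro T hT hTf
    have h1 : C.Definable L (⋂₀ T) := by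
      have := hTf.to_subtype
      rw [Set.sInter_eq_iInter]
      exact Set.definable_iInter_of_finite fun D =>
        (hd D (hT D.2)).mono Set.subset_union_left
    have h2 : C.Definable L (⋂ i : Fin n, {x : ℕ → M | x i = a i}) :=
      Set.definable_iInter_of_finite fun i =>
        definable_eq_const (i : ℕ) (Or.inr ⟨i, i.2, rfl⟩)
    obtain ⟨S, D, hD, hx⟩ := exists_definable_restrict (h1.inter h2)
    let S' := insert n S
    have hD' := (hD.preimage_comp (fun i : S => (⟨i, Finset.mem_insert_of_mem i.2⟩ : S'))).image_comp
      (fun _ : Fin 1 => (⟨n, Finset.mem_insert_self n S⟩ : S'))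
    convert! hD' using 1
    ext y
    simp only [P, Set.mem_ofPred_eq, Set.mem_image, Set.mem_preimage]
    constructor
    · rintro ⟨x, hxT, hxa, hxy⟩
      refine ⟨fun i => x i, (hx x).1 ⟨hxT, Set.mem_iInter.2 fun i => hxa i i.2⟩, ?_⟩
      funext j
      rw [Subsingleton.elim j 0]
      exact hxy
    · rintro ⟨g, hg, rfl⟩
      let x : ℕ → M := fun i => if h : i ∈ S' then g ⟨i, h⟩ else a i
      have hxD : x ∈ ⋂₀ T ∩ ⋂ i : Fin n, {x : ℕ → M | x i = a i} := by
        refine (hx x).2 ?_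
        convert hg using 1
        funext i
        exact dif_pos (Finset.mem_insert_of_mem i.2)
      refine ⟨x, hxD.1, fun i hi => Set.mem_iInter.1 hxD.2 ⟨i, hi⟩, ?_⟩
      exact dif_pos (Finset.mem_insert_self n S)
  obtain ⟨y, hy⟩ := hM C hC {φ | ∃ T ⊆ 𝓢, T.Finite ∧ P T = {v | φ.Realize v}} (by
    intro F hF hFf
    have hF' : ∀ φ ∈ F, ∃ T ⊆ 𝓢, T.Finite ∧ P T = {v | φ.Realize v} := fun φ hφ => hF hφ
    choose! T hT hTf hTP using hF'
    obtain ⟨x, hx, hxa⟩ := ha (⋃ φ ∈ F, T φ) (Set.iUnion₂_subset hT) (hFf.biUnion hTf)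
    refine ⟨fun _ => x n, fun φ hφ => ?_⟩
    have : (fun _ => x n) ∈ P (T φ) :=
      ⟨x, fun D hD => hx D (Set.mem_biUnion hφ hD), hxa, rfl⟩
    rw [hTP φ hφ] at this
    exact this)
  refine ⟨y 0, fun T hT hTf => ?_⟩
  obtain ⟨φ, hφ⟩ := hP T hT hTf
  have : y ∈ P T := by
    rw [hφ]
    exact hy φ ⟨T, hT, hTf, hφ⟩
  exact this

/-- Coordinates are chosen one at a time, keeping every finite subfamily compatible with the initial
segment. The limit sequence lies in each member because a definable set depends on finitely many
coordinates. -/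
theorem IsSaturated.sInter_nonempty_nat {κ : Cardinal.{w}} (hκ : ℵ_ 1 ≤ κ)
    (hM : IsSaturated L M κ) {B : Set M} (hB : #B < κ) {𝓢 : Set (Set (ℕ → M))}
    (hd : ∀ D ∈ 𝓢, B.Definable L D) (hfip : ∀ T ⊆ 𝓢, T.Finite → (⋂₀ T).Nonempty) :
    (⋂₀ 𝓢).Nonempty := by
  classical
  let Inv : ℕ → (ℕ → M) → Prop := fun n a =>
    ∀ T ⊆ 𝓢, T.Finite → ∃ x ∈ ⋂₀ T, ∀ i < n, x i = a i
  have step : ∀ n a, Inv n a → ∃ a', Inv (n + 1) a' ∧ ∀ i < n, a' i = a i := by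
    intro n a ha
    obtain ⟨c, hc⟩ := hM.exists_next hκ hB hd n a ha
    refine ⟨Function.update a n c, fun T hT hTf => ?_, fun i hi =>
      Function.update_of_ne hi.ne _ _⟩
    obtain ⟨x, hx, hxa, hxc⟩ := hc T hT hTf
    refine ⟨x, hx, fun i hi => ?_⟩
    rcases Nat.lt_succ_iff_lt_or_eq.1 hi with h | rfl
    · rw [hxa i h, Function.update_of_ne h.ne]
    · rw [hxc, Function.update_self]
  choose! nx hnx hag using step
  obtain ⟨x0, -⟩ := hfip ∅ (Set.empty_subset _) Set.finite_empty
  let s : ℕ → ℕ → M := fun n => Nat.rec x0 (fun n a => nx n a) n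
  have hs : ∀ n, Inv n (s n) := by
    intro n
    induction n with
    | zero =>
      intro T hT hTf
      obtain ⟨x, hx⟩ := hfip T hT hTf
      exact ⟨x, hx, fun i hi => absurd hi (Nat.not_lt_zero i)⟩
    | succ n ih => exact hnx n _ ih
  have hst : ∀ n k, ∀ i < n, s (n + k) i = s n i := by
    intro n k
    induction k with
    | zero => exact fun _ _ => rfl
    | succ k ih =>
      intro i hi
      rw [← ih i hi]
      exact hag (n + k) _ (hs _) i (by omega)
  refine ⟨fun n => s (n + 1) n, fun D hD => ?_⟩
  obtain ⟨S, D', -, hx⟩ := exists_definable_restrict (hd D hD)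
  let N := S.sup id + 1
  obtain ⟨x, hxD, hxs⟩ := hs N {D} (Set.singleton_subset_iff.2 hD) (Set.finite_singleton D)
  rw [hx]
  have := (hx x).1 (hxD D rfl)
  convert this using 1
  funext i
  have hi : (i : ℕ) < N := Nat.lt_succ_of_le (Finset.le_sup (f := id) i.2)
  rw [hxs i hi]
  obtain ⟨k, hk⟩ := Nat.exists_eq_add_of_le (Nat.succ_le_of_lt hi)
  rw [hk]
  exact (hst ((i : ℕ) + 1) k i (Nat.lt_succ_self _)).symm

/-- In an `ℵ₁`-saturated structure, each small family of definable sets in countably many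
variables that has the finite intersection property has nonempty intersection. -/
theorem IsSaturated.sInter_nonempty {κ : Cardinal.{w}} (hκ : ℵ_ 1 ≤ κ) (hM : IsSaturated L M κ)
    {B : Set M} (hB : #B < κ) {α : Type*} [Countable α] {𝓢 : Set (Set (α → M))}
    (hd : ∀ D ∈ 𝓢, B.Definable L D) (hfip : ∀ T ⊆ 𝓢, T.Finite → (⋂₀ T).Nonempty) :
    (⋂₀ 𝓢).Nonempty := by
  classical
  obtain ⟨e, he⟩ := exists_injective_nat α
  let pull : Set (α → M) → Set (ℕ → M) := fun D => (fun x => x ∘ e) ⁻¹' D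
  rcases isEmpty_or_nonempty M with hMe | ⟨⟨m0⟩⟩
  · obtain ⟨x, -⟩ := hfip ∅ (Set.empty_subset _) Set.finite_empty
    have : IsEmpty α := ⟨fun i => hMe.false (x i)⟩
    refine ⟨x, fun D hD => ?_⟩
    obtain ⟨y, hy⟩ := hfip {D} (Set.singleton_subset_iff.2 hD) (Set.finite_singleton D)
    rw [Subsingleton.elim x y]
    exact hy D rfl
  obtain ⟨x, hx⟩ := hM.sInter_nonempty_nat hκ hB (𝓢 := pull '' 𝓢)
    (by rintro _ ⟨D, hD, rfl⟩; exact (hd D hD).preimage_comp e)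
    (by
      intro T hT hTf
      obtain ⟨T', hT', hT'f, rfl⟩ := hTf.exists_subset_finite_image_eq hT
      obtain ⟨y, hy⟩ := hfip T' hT' hT'f
      refine ⟨Function.extend e y fun _ => m0, ?_⟩
      rintro _ ⟨D, hD, rfl⟩
      change Function.extend e y (fun _ => m0) ∘ e ∈ D
      rw [Function.extend_comp he]
      exact hy D hD)
  exact ⟨x ∘ e, fun D hD => hx _ ⟨D, hD, rfl⟩⟩

end Saturation

/-! ### Combinatorics of planar sets under exchange of heights. -/

section PlanarTraces

/-- The pairs `{a, b}` and `{c, d}` lie in disjoint intervals. -/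
def SepIntervals (a b c d : ℚ) : Prop :=
  (a < c ∧ a < d ∧ b < c ∧ b < d) ∨ (c < a ∧ c < b ∧ d < a ∧ d < b)

/-- The points `a` and `b` lie on the same side of the open interval `(l, u)`. -/
def OnOneSide (l u a b : ℚ) : Prop :=
  (a ≤ l ∧ b ≤ l) ∨ (u ≤ a ∧ u ≤ b)

/-- Two pairs of points of the plane lie in boxes with disjoint projections to both axes. -/
def SepPairs (P Q : (ℚ × ℚ) × (ℚ × ℚ)) : Prop :=
  SepIntervals P.1.1 P.2.1 Q.1.1 Q.2.1 ∧ SepIntervals P.1.2 P.2.2 Q.1.2 Q.2.2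

/-- `l` is a list of pairs of points in boxes with disjoint projections, the first point of each
being in `S` and the second one not. -/
def IsSplitBy (S : Set (ℚ × ℚ)) (l : List ((ℚ × ℚ) × (ℚ × ℚ))) : Prop :=
  l.Pairwise SepPairs ∧ ∀ P ∈ l, P.1 ∈ S ∧ P.2 ∉ S

/-- Pairs are picked along a diagonal: one in a box below both midpoints, all the others above both
midpoints. -/
theorem exists_isSplitBy_of_forall_box (S : Set (ℚ × ℚ)) (n : ℕ) : ∀ a b c d : ℚ, a < b → c < d →
    (∀ a' b' c' d', a < a' → a' < b' → b' < b → c < c' → c' < d' → d' < d →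
      ∃ p q : ℚ × ℚ, p ∈ S ∧ q ∉ S ∧ (a' < p.1 ∧ p.1 < b' ∧ c' < p.2 ∧ p.2 < d') ∧
        (a' < q.1 ∧ q.1 < b' ∧ c' < q.2 ∧ q.2 < d')) →
    ∃ l, IsSplitBy S l ∧ l.length = n ∧ ∀ P ∈ l, (a < P.1.1 ∧ a < P.2.1) ∧
      (c < P.1.2 ∧ c < P.2.2) := by
  induction n with
  | zero => exact fun a b c d _ _ _ => ⟨[], ⟨List.Pairwise.nil, by simp⟩, rfl, by simp⟩
  | succ n ih =>
    intro a b c d hab hcd h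
    obtain ⟨l, ⟨hl, hlS⟩, hn, hP⟩ := ih ((a + b) / 2) b ((c + d) / 2) d (by linarith) (by linarith)
      (fun a' b' c' d' h1 h2 h3 h4 h5 h6 =>
        h a' b' c' d' (by linarith) h2 h3 (by linarith) h5 h6)
    obtain ⟨p, q, hp, hq, ⟨p1, p2, p3, p4⟩, ⟨q1, q2, q3, q4⟩⟩ :=
      h (a + (b - a) / 4) (a + (b - a) / 2) (c + (d - c) / 4) (c + (d - c) / 2)
        (by linarith) (by linarith) (by linarith) (by linarith) (by linarith) (by linarith)
    refine ⟨(p, q) :: l, ⟨List.pairwise_cons.2 ⟨fun P hPl => ?_, hl⟩, ?_⟩, by simp [hn], ?_⟩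
    · obtain ⟨⟨h1, h2⟩, h3, h4⟩ := hP P hPl
      exact ⟨Or.inl ⟨by linarith, by linarith, by linarith, by linarith⟩,
        Or.inl ⟨by linarith, by linarith, by linarith, by linarith⟩⟩
    · intro P hPl
      rcases List.mem_cons.1 hPl with rfl | hPl
      · exact ⟨hp, hq⟩
      · exact hlS P hPl
    · intro P hPl
      rcases List.mem_cons.1 hPl with rfl | hPl
      · exact ⟨⟨by linarith, by linarith⟩, by linarith, by linarith⟩
      · obtain ⟨⟨h1, h2⟩, h3, h4⟩ := hP P hPl
        exact ⟨⟨by linarith, by linarith⟩, by linarith, by linarith⟩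

/-- A set that splits boundedly many boxes with disjoint projections is constant on a subbox of
each box. -/
theorem exists_constant_subbox {S : Set (ℚ × ℚ)} {k : ℕ}
    (hS : ∀ l, IsSplitBy S l → l.length < k) {a b c d : ℚ} (hab : a < b) (hcd : c < d) :
    ∃ a' b' c' d', a < a' ∧ a' < b' ∧ b' < b ∧ c < c' ∧ c' < d' ∧ d' < d ∧
      ((∀ p : ℚ × ℚ, a' < p.1 → p.1 < b' → c' < p.2 → p.2 < d' → p ∈ S) ∨
        (∀ p : ℚ × ℚ, a' < p.1 → p.1 < b' → c' < p.2 → p.2 < d' → p ∉ S)) := by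
  by_contra hcon
  obtain ⟨l, hl, hn, -⟩ := exists_isSplitBy_of_forall_box S k a b c d hab hcd (by
    intro a' b' c' d' h1 h2 h3 h4 h5 h6
    by_contra hc
    refine hcon ⟨a', b', c', d', h1, h2, h3, h4, h5, h6, ?_⟩
    by_contra hc'
    rw [not_or] at hc'
    obtain ⟨hq, hp⟩ := hc'
    push Not at hp hq
    obtain ⟨q, hq1, hq2, hq3, hq4, hqS⟩ := hq
    obtain ⟨p, hp1, hp2, hp3, hp4, hpS⟩ := hp
    exact hc ⟨p, q, hpS, hqS, ⟨hp1, hp2, hp3, hp4⟩, ⟨hq1, hq2, hq3, hq4⟩⟩)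
  exact (hS l hl).ne hn

/-- The old pairs lie outside the window `(l₁, l₄) × (j₀, j₁)` in both projections. They therefore
avoid the strips where `S'` may differ from `S`, and are separated from the new pair inside the
window. -/
theorem isSplitBy_cons {S S' : Set (ℚ × ℚ)} {l : List ((ℚ × ℚ) × (ℚ × ℚ))} (hl : IsSplitBy S l)
    {l₁ l₄ j₀ j₁ s₁ s₂ t₁ t₂ : ℚ} (hs : l₁ < s₁ ∧ s₂ < l₄) (ht : j₀ < t₁ ∧ t₂ < j₁)
    (hout : ∀ P ∈ l, OnOneSide l₁ l₄ P.1.1 P.2.1 ∧ OnOneSide j₀ j₁ P.1.2 P.2.2)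
    (hag : ∀ p : ℚ × ℚ, (p.1 < s₁ ∨ s₂ < p.1) → (p.2 < t₁ ∨ t₂ < p.2) → (p ∈ S' ↔ p ∈ S))
    {p q : ℚ × ℚ} (hp : p ∈ S') (hq : q ∉ S')
    (h1 : l₁ < p.1 ∧ p.1 < l₄ ∧ l₁ < q.1 ∧ q.1 < l₄)
    (h2 : j₀ < p.2 ∧ p.2 < j₁ ∧ j₀ < q.2 ∧ q.2 < j₁) : IsSplitBy S' ((p, q) :: l) := by
  refine ⟨List.pairwise_cons.2 ⟨fun P hP => ?_, hl.1⟩, fun P hP => ?_⟩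
  · obtain ⟨ho1, ho2⟩ := hout P hP
    constructor
    · rcases ho1 with ho | ho
      · exact Or.inr ⟨by linarith, by linarith, by linarith, by linarith⟩
      · exact Or.inl ⟨by linarith, by linarith, by linarith, by linarith⟩
    · rcases ho2 with ho | ho
      · exact Or.inr ⟨by linarith, by linarith, by linarith, by linarith⟩
      · exact Or.inl ⟨by linarith, by linarith, by linarith, by linarith⟩
  · rcases List.mem_cons.1 hP with rfl | hP
    · exact ⟨hp, hq⟩
    · obtain ⟨ho1, ho2⟩ := hout P hP
      have e1 : P.1 ∈ S' ↔ P.1 ∈ S := hag P.1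
        (ho1.imp (fun h => by linarith) (fun h => by linarith))
        (ho2.imp (fun h => by linarith) (fun h => by linarith))
      have e2 : P.2 ∈ S' ↔ P.2 ∈ S := hag P.2
        (ho1.imp (fun h => by linarith) (fun h => by linarith))
        (ho2.imp (fun h => by linarith) (fun h => by linarith))
      rw [e1, e2]
      exact hl.2 P hP

/-- A family of subsets of the plane that contains a horizontal half-plane and is closed under
exchanging the heights of two points contains sets that split arbitrarily many boxes with disjoint
projections. -/
theorem exists_isSplitBy_of_swap (𝒯 : Set (Set (ℚ × ℚ))) {k : ℕ}
    (hswap : ∀ S ∈ 𝒯, ∀ s₁ s₂ t₁ t₂ : ℚ, s₁ < s₂ → t₁ < t₂ → ∃ S' ∈ 𝒯,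
      (∀ p : ℚ × ℚ, (p.1 < s₁ ∨ s₂ < p.1) → (p.2 < t₁ ∨ t₂ < p.2) → (p ∈ S' ↔ p ∈ S)) ∧
      ((s₂, t₁) ∈ S' ↔ (s₁, t₁) ∈ S) ∧ ((s₁, t₂) ∈ S' ↔ (s₂, t₂) ∈ S))
    (hcut : ∃ S ∈ 𝒯, ∀ p : ℚ × ℚ, (p.1 < 0 → p ∈ S) ∧ (0 < p.1 → p ∉ S)) :
    ∃ S ∈ 𝒯, ∃ l, IsSplitBy S l ∧ k ≤ l.length := by
  by_contra hvc
  push Not at hvc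
  -- Invariant: `S` contains a left box and misses a right box at the same heights, and `n` split
  -- pairs project outside the window spanned by these boxes. Each exchange shrinks the window and
  -- gains a pair.
  have key : ∀ n : ℕ, ∃ S ∈ 𝒯, ∃ l₁ l₂ l₃ l₄ j₀ j₁ : ℚ, ∃ l, l₁ < l₂ ∧ l₂ ≤ l₃ ∧ l₃ < l₄ ∧
      j₀ < j₁ ∧ (∀ p : ℚ × ℚ, l₁ < p.1 → p.1 < l₂ → j₀ < p.2 → p.2 < j₁ → p ∈ S) ∧
      (∀ p : ℚ × ℚ, l₃ < p.1 → p.1 < l₄ → j₀ < p.2 → p.2 < j₁ → p ∉ S) ∧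
      IsSplitBy S l ∧ l.length = n ∧
      ∀ P ∈ l, OnOneSide l₁ l₄ P.1.1 P.2.1 ∧ OnOneSide j₀ j₁ P.1.2 P.2.2 := by
    intro n
    induction n with
    | zero =>
      obtain ⟨S, hS, hc⟩ := hcut
      exact ⟨S, hS, -1, 0, 0, 1, 0, 1, [], by norm_num, le_rfl, by norm_num, by norm_num,
        fun p _ h _ _ => (hc p).1 h, fun p h _ _ _ => (hc p).2 h, ⟨List.Pairwise.nil, by simp⟩,
        rfl, by simp⟩
    | succ n ih =>
      obtain ⟨S, hS, l₁, l₂, l₃, l₄, j₀, j₁, l, h12, h23, h34, hj, hin, hout, hl, hn, hside⟩ := ih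
      obtain ⟨s₁, hs1, hs1'⟩ := exists_between h12
      obtain ⟨s₂, hs2, hs2'⟩ := exists_between h34
      obtain ⟨t₂, ht2, ht2'⟩ := exists_between hj
      obtain ⟨t₁, ht1, ht1'⟩ := exists_between ht2
      obtain ⟨t₀, ht0, ht0'⟩ := exists_between ht1
      obtain ⟨S', hS', hag, hx1, hx2⟩ := hswap S hS s₁ s₂ t₁ t₂ (by linarith) ht1'
      have hx1 : (s₂, t₁) ∈ S' := hx1.2 (hin _ hs1 hs1' ht1 (by linarith))
      have hx2 : (s₁, t₂) ∉ S' := fun h => hout _ hs2 hs2' ht2 ht2' (hx2.1 h)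
      -- A constant box between the two columns and below the exchanged heights. If it lies in `S'`
      -- it replaces the left box, freeing a point there to pair with `(s₁, t₂)`; otherwise it
      -- replaces the right box, freeing a point to pair with `(s₂, t₁)`.
      obtain ⟨a, b, c, e, ha, hab, hb, hc, hce, he, hW⟩ :=
        exists_constant_subbox (hvc S' hS') (a := s₁) (b := s₂) (c := j₀) (d := t₀)
          (by linarith) ht0
      rcases hW with hW | hW
      · obtain ⟨s, hs, hs'⟩ := exists_between hs1
        obtain ⟨t, ht, ht'⟩ := exists_between ht2'
        have hp : (s, t) ∈ S' := (hag (s, t) (Or.inl hs') (Or.inr ht)).2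
          (hin _ hs (by simp only; linarith) (by simp only; linarith) ht')
        refine ⟨S', hS', a, b, s₂, l₄, c, e, ((s, t), (s₁, t₂)) :: l, hab, hb.le, hs2', hce, hW,
          fun p h1 h2 h3 h4 h5 => ?_, ?_, by simp [hn], ?_⟩
        · exact hout p (by linarith) h2 (by linarith) (by linarith)
            ((hag p (Or.inr h1) (Or.inl (by linarith))).1 h5)
        · refine isSplitBy_cons hl ⟨hs1, hs2'⟩ ⟨ht1, ht2'⟩ hside hag hp hx2 ?_ ?_
          · refine ⟨?_, ?_, ?_, ?_⟩ <;> simp only <;> linarith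
          · refine ⟨?_, ?_, ?_, ?_⟩ <;> simp only <;> linarith
        · intro P hP
          rcases List.mem_cons.1 hP with rfl | hP
          · exact ⟨Or.inl ⟨by simp only; linarith, by simp only; linarith⟩,
              Or.inr ⟨by simp only; linarith, by simp only; linarith⟩⟩
          · obtain ⟨ho1, ho2⟩ := hside P hP
            exact ⟨ho1.imp (fun h => ⟨by linarith, by linarith⟩) fun h => h,
              ho2.imp (fun h => ⟨by linarith, by linarith⟩) fun h => ⟨by linarith, by linarith⟩⟩
      · obtain ⟨s, hs, hs'⟩ := exists_between hs2'
        obtain ⟨t, ht, ht'⟩ := exists_between ht0'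
        have hq : (s, t) ∉ S' := fun h =>
          hout _ (by simp only; linarith) hs' (by simp only; linarith) (by simp only; linarith)
            ((hag (s, t) (Or.inr hs) (Or.inl ht')).1 h)
        refine ⟨S', hS', l₁, s₁, a, b, c, e, ((s₂, t₁), (s, t)) :: l, hs1, ha.le, hab, hce,
          fun p h1 h2 h3 h4 => ?_, hW, ?_, by simp [hn], ?_⟩
        · exact (hag p (Or.inl h2) (Or.inl (by linarith))).2
            (hin p h1 (by linarith) (by linarith) (by linarith))
        · refine isSplitBy_cons hl ⟨hs1, hs2'⟩ ⟨ht1, ht2'⟩ hside hag hx1 hq ?_ ?_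
          · refine ⟨?_, ?_, ?_, ?_⟩ <;> simp only <;> linarith
          · refine ⟨?_, ?_, ?_, ?_⟩ <;> simp only <;> linarith
        · intro P hP
          rcases List.mem_cons.1 hP with rfl | hP
          · exact ⟨Or.inr ⟨by simp only; linarith, by simp only; linarith⟩,
              Or.inr ⟨by simp only; linarith, by simp only; linarith⟩⟩
          · obtain ⟨ho1, ho2⟩ := hside P hP
            exact ⟨ho1.imp (fun h => h) fun h => ⟨by linarith, by linarith⟩,
              ho2.imp (fun h => ⟨by linarith, by linarith⟩) fun h => ⟨by linarith, by linarith⟩⟩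
  obtain ⟨S, hS, -, -, -, -, -, -, l, -, -, -, -, -, -, hl, hn, -⟩ := key k
  exact (hvc S hS l hl).ne hn

end PlanarTraces

/-! ### Iterated ultrafilter quantifiers. -/

section GenericQuantifier

variable {Q Q' : Type*} [DecidableEq Q] [DecidableEq Q']

/-- `P` holds for almost all functions `h`, whose values at the entries of the list are chosen
one after the other, generically with respect to a nonprincipal ultrafilter. -/
def Generically : List Q → ((Q → ℕ) → Prop) → Prop
  | [], P => P 0
  | q :: l, P => ∀ᶠ j in (Filter.hyperfilter ℕ : Filter ℕ),
      Generically l fun h => P (Function.update h q j)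

theorem Generically.mono {l : List Q} : ∀ {P P' : (Q → ℕ) → Prop}, Generically l P →
    (∀ h, P h → P' h) → Generically l P' := by
  induction l with
  | nil => exact fun h hP => hP _ h
  | cons q l ih =>
    exact fun h hP => Filter.Eventually.mono h fun j hj => ih hj fun h => hP _

theorem generically_congr {l : List Q} {P P' : (Q → ℕ) → Prop} (h : ∀ x, P x ↔ P' x) :
    Generically l P ↔ Generically l P' :=
  ⟨fun H => H.mono fun x => (h x).1, fun H => H.mono fun x => (h x).2⟩

theorem Generically.and {l : List Q} : ∀ {P P' : (Q → ℕ) → Prop}, Generically l P →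
    Generically l P' → Generically l fun h => P h ∧ P' h := by
  induction l with
  | nil => exact fun h h' => ⟨h, h'⟩
  | cons q l ih => exact fun h h' => (Filter.Eventually.and h h').mono fun j hj => ih hj.1 hj.2

/-- An ultrafilter decides every set. This self-duality lets the quantifier define complete types.
-/
theorem generically_not {l : List Q} : ∀ {P : (Q → ℕ) → Prop},
    Generically l (fun h => ¬ P h) ↔ ¬ Generically l P := by
  induction l with
  | nil => exact Iff.rfl
  | cons q l ih =>
    intro P
    simp only [Generically, ih]
    exact Ultrafilter.eventually_not

theorem generically_of_forall (l : List Q) : ∀ {P : (Q → ℕ) → Prop}, (∀ h, P h) →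
    Generically l P := by
  induction l with
  | nil => exact fun h => h 0
  | cons q l ih => exact fun h => Filter.Eventually.of_forall fun j => ih fun _ => h _

theorem Generically.exists {l : List Q} : ∀ {P : (Q → ℕ) → Prop}, Generically l P → ∃ h, P h := by
  induction l with
  | nil => exact fun h => ⟨0, h⟩
  | cons q l ih =>
    intro P h
    obtain ⟨j, hj⟩ := Filter.Eventually.exists h
    obtain ⟨h, hh⟩ := ih hj
    exact ⟨_, hh⟩

theorem generically_forall_mem_lt (l : List Q) (N : ℕ) :
    Generically l fun h => ∀ q ∈ l, N < h q := by
  induction l with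
  | nil => exact fun q hq => absurd hq List.not_mem_nil
  | cons q l ih =>
    refine Filter.Eventually.mono (Nat.hyperfilter_le_atTop (Filter.eventually_gt_atTop N))
      fun j hj => ?_
    refine ih.mono fun h hh q' hq' => ?_
    by_cases hqq : q' = q
    · rw [hqq, Function.update_self]
      exact hj
    · rw [Function.update_of_ne hqq]
      exact hh q' ((List.mem_cons.1 hq').resolve_left hqq)

/-- Later entries are chosen after earlier ones, and a nonprincipal ultrafilter puts them beyond any
value already fixed. -/
theorem generically_strictMonoOn [LinearOrder Q] {l : List Q} (hl : l.Pairwise (· < ·)) :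
    Generically l fun h => ∀ q ∈ l, ∀ q' ∈ l, q < q' → h q < h q' := by
  induction l with
  | nil => exact fun q hq => absurd hq List.not_mem_nil
  | cons q l ih =>
    obtain ⟨hq, hl⟩ := List.pairwise_cons.1 hl
    refine Filter.Eventually.of_forall fun j => ?_
    refine ((ih hl).and (generically_forall_mem_lt l j)).mono fun h hh x hx y hy hxy => ?_
    have hyl : y ∈ l := by
      rcases List.mem_cons.1 hy with rfl | hy
      · rcases List.mem_cons.1 hx with rfl | hx
        · exact absurd hxy (lt_irrefl _)
        · exact absurd hxy (hq x hx).not_gt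
      · exact hy
    rw [Function.update_of_ne (hq y hyl).ne']
    rcases List.mem_cons.1 hx with rfl | hx
    · rw [Function.update_self]
      exact hh.2 y hyl
    · rw [Function.update_of_ne (hq x hx).ne']
      exact hh.1 x hx y hyl hxy

/-- Quantifying over an entry that `P` does not read has no effect, so such entries can be dropped.
-/
theorem generically_of_sublist {l l' : List Q} (hll : l.Sublist l') (hl : l'.Nodup) :
    ∀ {P : (Q → ℕ) → Prop}, (∀ h h' : Q → ℕ, (∀ q ∈ l, h q = h' q) → (P h ↔ P h')) →
      (Generically l' P ↔ Generically l P) := by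
  induction hll with
  | slnil => exact fun _ => Iff.rfl
  | @cons l l' q hll ih =>
    intro P hP
    obtain ⟨hq, hl⟩ := List.nodup_cons.1 hl
    have : ∀ j, Generically l' (fun h => P (Function.update h q j)) ↔ Generically l P := by
      intro j
      rw [← ih hl hP]
      refine generically_congr fun h => hP _ _ fun x hx => Function.update_of_ne ?_ _ _
      rintro rfl
      exact hq (hll.subset hx)
    simp only [Generically, this, Filter.eventually_const]
  | @cons_cons l l' q hll ih =>
    intro P hP
    obtain ⟨hq, hl⟩ := List.nodup_cons.1 hl
    refine Filter.eventually_congr (Filter.Eventually.of_forall fun j => ih hl fun h h' hh =>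
      hP _ _ fun x hx => ?_)
    by_cases hxq : x = q
    · rw [hxq, Function.update_self, Function.update_self]
    · rw [Function.update_of_ne hxq, Function.update_of_ne hxq]
      exact hh x ((List.mem_cons.1 hx).resolve_left hxq)

theorem generically_map {l : List Q} (hl : l.Nodup) (σ : Q → Q')
    (hσ : ∀ x ∈ l, ∀ y ∈ l, σ x = σ y → x = y) :
    ∀ {P : (Q → ℕ) → Prop}, (∀ h h' : Q → ℕ, (∀ q ∈ l, h q = h' q) → (P h ↔ P h')) →
      (Generically (l.map σ) (fun h => P (h ∘ σ)) ↔ Generically l P) := by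
  induction l with
  | nil => exact fun hP => hP _ _ fun _ h => absurd h List.not_mem_nil
  | cons q l ih =>
    intro P hP
    obtain ⟨hq, hl⟩ := List.nodup_cons.1 hl
    refine Filter.eventually_congr (Filter.Eventually.of_forall fun j => ?_)
    rw [← ih hl (fun x hx y hy => hσ x (List.mem_cons_of_mem q hx) y (List.mem_cons_of_mem q hy))
      (P := fun h => P (Function.update h q j))]
    · refine generically_congr fun h => hP _ _ fun x hx => ?_
      by_cases hxq : x = q
      · rw [hxq, Function.update_self, Function.comp_apply, Function.update_self]
      · rw [Function.update_of_ne hxq, Function.comp_apply, Function.update_of_ne]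
        · rfl
        · exact fun h => hxq (hσ x hx q List.mem_cons_self h)
    · intro h h' hh
      refine hP _ _ fun x hx => ?_
      by_cases hxq : x = q
      · rw [hxq, Function.update_self, Function.update_self]
      · rw [Function.update_of_ne hxq, Function.update_of_ne hxq]
        exact hh x ((List.mem_cons.1 hx).resolve_left hxq)

theorem generically_sort_of_subset [LinearOrder Q] {s s' : Finset Q} (hs : s ⊆ s')
    {P : (Q → ℕ) → Prop} (hP : ∀ h h' : Q → ℕ, (∀ q ∈ s, h q = h' q) → (P h ↔ P h')) :
    Generically s'.sort P ↔ Generically s.sort P := by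
  refine generically_of_sublist ?_ (s'.sort_nodup _) fun h h' hh => hP h h' fun q hq =>
    hh q ((Finset.mem_sort _).2 hq)
  exact List.sublist_of_subperm_of_sortedLE
    (List.subperm_of_subset (s.sort_nodup _) fun x hx =>
      (Finset.mem_sort _).2 (hs ((Finset.mem_sort _).1 hx)))
    s.sortedLT_sort.sortedLE s'.sortedLT_sort.sortedLE

theorem generically_sort_image [LinearOrder Q] [LinearOrder Q'] {s : Finset Q} {s' : Finset Q'}
    {σ : Q → Q'} (hσ : ∀ x ∈ s, ∀ y ∈ s, x < y → σ x < σ y) (hs : s.image σ = s')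
    {P : (Q → ℕ) → Prop} (hP : ∀ h h' : Q → ℕ, (∀ q ∈ s, h q = h' q) → (P h ↔ P h')) :
    Generically s'.sort (fun h => P (h ∘ σ)) ↔ Generically s.sort P := by
  have hinj : ∀ x ∈ s, ∀ y ∈ s, σ x = σ y → x = y := by
    intro x hx y hy h
    rcases lt_trichotomy x y with hxy | hxy | hxy
    · exact absurd h (hσ x hx y hy hxy).ne
    · exact hxy
    · exact absurd h (hσ y hy x hx hxy).ne'
  have hsorted : (s.sort.map σ).Pairwise (· < ·) := by
    rw [List.pairwise_map]
    exact s.sortedLT_sort.pairwise.imp_of_mem fun hx hy h =>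
      hσ _ ((Finset.mem_sort _).1 hx) _ ((Finset.mem_sort _).1 hy) h
  have hlist : s'.sort = s.sort.map σ := by
    refine List.Perm.eq_of_sortedLE s'.sortedLT_sort.sortedLE
      (hsorted.imp fun h => h.le).sortedLE ?_
    refine (List.perm_ext_iff_of_nodup (s'.sort_nodup _) (hsorted.imp fun h => h.ne)).2 fun x => ?_
    simp [← hs]
  rw [hlist]
  exact generically_map (s.sort_nodup _) σ
    (fun x hx y hy => hinj x ((Finset.mem_sort _).1 hx) y ((Finset.mem_sort _).1 hy))
    fun h h' hh => hP h h' fun q hq => hh q ((Finset.mem_sort _).2 hq)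

end GenericQuantifier

/-! ### Extraction of an indiscernible grid. -/

section IndiscernibleGrid

variable {L : FirstOrder.Language.{u, v}} {M : Type w} [L.Structure M]

/-- Two tuples of points of `ℚ^m` have the same order type in each coordinate. -/
def SamePattern {m : ℕ} {ι : Type*} (u v : ι → Fin m → ℚ) : Prop :=
  ∀ i j k, u j i < u k i ↔ v j i < v k i

theorem SamePattern.eq_iff {m : ℕ} {ι : Type*} {u v : ι → Fin m → ℚ} (h : SamePattern u v)
    (i : Fin m) (j k : ι) : u j i = u k i ↔ v j i = v k i := by
  have h1 := h i j k
  have h2 := h i k j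
  constructor
  · intro e
    exact le_antisymm (not_lt.1 (fun hlt => (h2.2 hlt).ne' e)) (not_lt.1 fun hlt => (h1.2 hlt).ne e)
  · intro e
    exact le_antisymm (not_lt.1 (fun hlt => (h2.1 hlt).ne' e)) (not_lt.1 fun hlt => (h1.1 hlt).ne e)

/-- The coordinates, labelled by the axis, of the points of a finite tuple. -/
def coords {m n : ℕ} (u : Fin n → Fin m → ℚ) : Finset (Fin m ×ₗ ℚ) :=
  Finset.univ.image fun x : Fin m × Fin n => toLex (x.1, u x.2 x.1)

theorem mem_coords {m n : ℕ} (u : Fin n → Fin m → ℚ) (i : Fin m) (j : Fin n) :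
    toLex (i, u j i) ∈ coords u :=
  Finset.mem_image.2 ⟨(i, j), Finset.mem_univ _, rfl⟩

/-- A point of `ℚ^m` evaluated at a function that assigns natural numbers to coordinates. -/
def evalPoint {m : ℕ} (h : Fin m ×ₗ ℚ → ℕ) (g : Fin m → ℚ) : Fin m → ℕ :=
  fun i => h (toLex (i, g i))

/-- Equal patterns give a bijection between the coordinate sets that preserves the axis and the
order, hence the order of quantification in the sorted lists. Generic truth is invariant under such
a renaming. -/
theorem generically_coords_congr {m n d : ℕ} (a : (Fin m → ℕ) → Fin d → M)
    {u v : Fin n → Fin m → ℚ} (huv : SamePattern u v) (R : Set (Fin n × Fin d → M)) :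
    Generically (coords v).sort (fun h => (fun y => a (evalPoint h (v y.1)) y.2) ∈ R) ↔
      Generically (coords u).sort (fun h => (fun y => a (evalPoint h (u y.1)) y.2) ∈ R) := by
  classical
  let σ : Fin m ×ₗ ℚ → Fin m ×ₗ ℚ := fun x =>
    if h : ∃ j, u j (ofLex x).1 = (ofLex x).2 then toLex ((ofLex x).1, v h.choose (ofLex x).1) else x
  have hσ : ∀ i j, σ (toLex (i, u j i)) = toLex (i, v j i) := by
    intro i j
    have h : ∃ k, u k i = u j i := ⟨j, rfl⟩
    have : σ (toLex (i, u j i)) = toLex (i, v h.choose i) := dif_pos h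
    rw [this, (huv.eq_iff i h.choose j).1 h.choose_spec]
  have hmono : ∀ x ∈ coords u, ∀ y ∈ coords u, x < y → σ x < σ y := by
    intro x hx y hy hxy
    obtain ⟨⟨i, j⟩, -, rfl⟩ := Finset.mem_image.1 hx
    obtain ⟨⟨i', j'⟩, -, rfl⟩ := Finset.mem_image.1 hy
    simp only [hσ] at hxy ⊢
    rw [Prod.Lex.toLex_lt_toLex] at hxy ⊢
    rcases hxy with h | ⟨h, h'⟩
    · exact Or.inl h
    · simp only at h h'
      subst h
      exact Or.inr ⟨rfl, (huv i j j').1 h'⟩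
  have himg : (coords u).image σ = coords v := by
    simp only [coords, Finset.image_image]
    refine Finset.image_congr fun x _ => ?_
    exact hσ x.1 x.2
  rw [← generically_sort_image hmono himg
    (P := fun h => (fun y => a (evalPoint h (u y.1)) y.2) ∈ R)]
  · refine generically_congr fun h => ?_
    have : ∀ j, evalPoint (h ∘ σ) (u j) = evalPoint h (v j) := fun j => funext fun i => by
      simp only [evalPoint, Function.comp_apply, hσ]
    simp only [this]
  · intro h h' hh
    have : ∀ j, evalPoint h (u j) = evalPoint h' (u j) := fun j => funext fun i =>
      hh _ (mem_coords u i j)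
    simp only [this]

/-- A grid of tuples indexed by `ℕ^m` in a saturated structure can be replaced by an
indiscernible one indexed by `ℚ^m`. -/
theorem exists_indiscernible_grid {κ : Cardinal.{w}} (hκ : ℵ_ 1 ≤ κ) (hM : IsSaturated L M κ)
    {B : Set M} (hB : #B < κ) {m d : ℕ} (a : (Fin m → ℕ) → Fin d → M) :
    ∃ b : (Fin m → ℚ) → Fin d → M,
      (∀ (n : ℕ) (u v : Fin n → Fin m → ℚ), SamePattern u v → ∀ R : Set (Fin n × Fin d → M),
        B.Definable L R → ((fun y => b (u y.1) y.2) ∈ R ↔ (fun y => b (v y.1) y.2) ∈ R)) ∧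
      (∀ (n : ℕ) (u : Fin n → Fin m → ℚ) (R : Set (Fin n × Fin d → M)), B.Definable L R →
        (∀ g : Fin n → Fin m → ℕ, (∀ i j k, u j i < u k i → g j i < g k i) →
          (fun y => a (g y.1) y.2) ∈ R) → (fun y => b (u y.1) y.2) ∈ R) := by
  classical
  let ev : (Fin m ×ₗ ℚ → ℕ) → (Fin m → ℚ) × Fin d → M := fun h x => a (evalPoint h x.1) x.2
  -- The type of the limit grid. Requiring truth for all `s ⊇ s₀` lets finitely many conditions be
  -- combined over one common `s`.
  let 𝓢 : Set (Set ((Fin m → ℚ) × Fin d → M)) := {D | B.Definable L D ∧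
    ∃ s₀ : Finset (Fin m ×ₗ ℚ), ∀ s, s₀ ⊆ s → Generically s.sort fun h => ev h ∈ D}
  obtain ⟨x, hx⟩ := hM.sInter_nonempty hκ hB (𝓢 := 𝓢) (fun D hD => hD.1) (by
    intro T hT hTf
    have hT' : ∀ D ∈ T, ∃ s₀ : Finset (Fin m ×ₗ ℚ), ∀ s, s₀ ⊆ s →
      Generically s.sort fun h => ev h ∈ D := fun D hD => (hT hD).2
    choose! s₀ hs₀ using hT'
    let s := hTf.toFinset.biUnion s₀
    have : ∀ F : Finset (Set ((Fin m → ℚ) × Fin d → M)), F ⊆ hTf.toFinset →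
        Generically s.sort fun h => ∀ D ∈ F, ev h ∈ D := by
      intro F
      induction F using Finset.induction_on with
      | empty => exact fun _ => generically_of_forall _ fun h D hD => absurd hD (Finset.notMem_empty D)
      | insert D F _ ih =>
        intro hF
        have hD : D ∈ hTf.toFinset := hF (Finset.mem_insert_self D F)
        refine ((hs₀ D (hTf.mem_toFinset.1 hD) s (Finset.subset_biUnion_of_mem s₀ hD)).and
          (ih ((Finset.subset_insert D F).trans hF))).mono fun h hh D' hD' => ?_
        rcases Finset.mem_insert.1 hD' with rfl | hD'
        · exact hh.1
        · exact hh.2 D' hD'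
    obtain ⟨h, hh⟩ := (this _ (Finset.Subset.refl _)).exists
    exact ⟨ev h, fun D hD => hh D (hTf.mem_toFinset.2 hD)⟩)
  -- By self-duality, either `R` or its complement contributes a member of `𝓢`, so this is an
  -- equivalence.
  have truth : ∀ (n : ℕ) (u : Fin n → Fin m → ℚ) (R : Set (Fin n × Fin d → M)),
      B.Definable L R → ((fun y : Fin n × Fin d => x (u y.1, y.2)) ∈ R ↔
        Generically (coords u).sort (fun h => (fun y => a (evalPoint h (u y.1)) y.2) ∈ R)) := by
    intro n u R hR
    have hloc : ∀ h h' : Fin m ×ₗ ℚ → ℕ, (∀ q ∈ coords u, h q = h' q) →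
        ((fun y : Fin n × Fin d => a (evalPoint h (u y.1)) y.2) ∈ R ↔
          (fun y : Fin n × Fin d => a (evalPoint h' (u y.1)) y.2) ∈ R) := by
      intro h h' hh
      have : ∀ j, evalPoint h (u j) = evalPoint h' (u j) := fun j => funext fun i =>
        hh _ (mem_coords u i j)
      simp only [this]
    have hdef := hR.preimage_comp (fun y : Fin n × Fin d => ((u y.1, y.2) : (Fin m → ℚ) × Fin d))
    by_cases hg : Generically (coords u).sort (fun h => (fun y => a (evalPoint h (u y.1)) y.2) ∈ R)
    · refine iff_of_true (hx _ ⟨hdef, coords u, fun s hs => ?_⟩) hg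
      exact (generically_sort_of_subset hs hloc).2 hg
    · refine iff_of_false (hx _ ⟨hdef.compl, coords u, fun s hs => ?_⟩) hg
      refine (generically_sort_of_subset hs fun h h' hh => not_congr (hloc h h' hh)).2 ?_
      exact generically_not.2 hg
  refine ⟨fun g q => x (g, q), fun n u v huv R hR => ?_, fun n u R hR hall => ?_⟩
  · exact (truth n u R hR).trans
      ((generically_coords_congr a huv R).symm.trans (truth n v R hR).symm)
  · refine (truth n u R hR).2 ?_
    refine (generically_strictMonoOn (coords u).sortedLT_sort.pairwise).mono fun h hh => ?_
    refine hall (fun j => evalPoint h (u j)) fun i j k hjk => ?_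
    refine hh _ ((Finset.mem_sort _).2 (mem_coords u i j)) _
      ((Finset.mem_sort _).2 (mem_coords u i k)) ?_
    exact Prod.Lex.toLex_lt_toLex.2 (Or.inr ⟨rfl, hjk⟩)

end IndiscernibleGrid

/-! ### Traces on the grid and separation of sign vectors. -/

section Separation

variable {L : FirstOrder.Language.{u, v}} {M : Type w} [L.Structure M]

theorem definable_fiber {α β : Type*} [Finite α] [Finite β] {B C : Set M} {D : Set (α ⊕ β → M)}
    (hD : B.Definable L D) (a : β → M) (hBC : B ⊆ C) (ha : ∀ q, a q ∈ C) :
    C.Definable L {x : α → M | Sum.elim x a ∈ D} := by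
  have h := ((hD.mono hBC).inter (Set.definable_iInter_of_finite fun q : β =>
    definable_eq_const (L := L) (Sum.inr q : α ⊕ β) (ha q))).image_comp (Sum.inl : α → α ⊕ β)
  convert! h using 1
  ext x
  simp only [Set.mem_ofPred_eq, Set.mem_image, Set.mem_inter_iff, Set.mem_iInter]
  constructor
  · exact fun hx => ⟨Sum.elim x a, ⟨hx, fun q => rfl⟩, rfl⟩
  · rintro ⟨y, ⟨hy, hya⟩, rfl⟩
    have : Sum.elim (y ∘ Sum.inl) a = y := by
      funext s
      rcases s with s | s
      · rfl
      · exact (hya s).symm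
    rwa [this]

theorem definable_fiber_left {α β : Type*} [Finite α] [Finite β] {B C : Set M}
    {D : Set (α ⊕ β → M)} (hD : B.Definable L D) (a : α → M) (hBC : B ⊆ C) (ha : ∀ q, a q ∈ C) :
    C.Definable L {z : β → M | Sum.elim a z ∈ D} := by
  have h := definable_fiber (hD.preimage_comp (Sum.swap : α ⊕ β → β ⊕ α)) a hBC ha
  convert! h using 1
  ext z
  have : Sum.elim z a ∘ Sum.swap = Sum.elim a z := by
    funext s; rcases s with s | s <;> rfl
  simp only [Set.mem_ofPred_eq, Set.mem_preimage, this]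

/-- A finitely consistent pattern of instances of a relation on countably many tuples is
realized in a saturated structure. -/
theorem IsSaturated.exists_trace {κ : Cardinal.{w}} (hκ : ℵ_ 1 ≤ κ) (hM : IsSaturated L M κ)
    {B : Set M} (hB : #B < κ) {d k : ℕ} {D : Set (Fin d ⊕ Fin k → M)} (hD : B.Definable L D)
    {ι : Type*} [Countable ι] (β : ι → Fin d → M) (X pat : Set ι)
    (hfin : ∀ (n : ℕ) (p : Fin n → ι), (∀ j, p j ∈ X) →
      ∃ z : Fin k → M, ∀ j, Sum.elim (β (p j)) z ∈ D ↔ p j ∈ pat) :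
    ∃ z : Fin k → M, ∀ p ∈ X, Sum.elim (β p) z ∈ D ↔ p ∈ pat := by
  classical
  let C : Set M := B ∪ Set.range fun x : ι × Fin d => β x.1 x.2
  have hC : #C < κ := mk_union_countable_lt hκ hB (Set.countable_range _)
  let A : ι → Set (Fin k → M) := fun p => {z | Sum.elim (β p) z ∈ D ↔ p ∈ pat}
  have hA : ∀ p, C.Definable L (A p) := by
    intro p
    have h : C.Definable L {z : Fin k → M | Sum.elim (β p) z ∈ D} :=
      definable_fiber_left hD (β p) Set.subset_union_left fun q => Or.inr ⟨(p, q), rfl⟩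
    by_cases hp : p ∈ pat
    · simp only [A, hp, iff_true]
      exact h
    · simp only [A, hp, iff_false]
      exact h.compl
  obtain ⟨z, hz⟩ := hM.sInter_nonempty hκ hC (𝓢 := A '' X)
    (by rintro _ ⟨p, -, rfl⟩; exact hA p)
    (by
      intro T hT hTf
      obtain ⟨Y, hY, hYf, rfl⟩ := hTf.exists_subset_finite_image_eq hT
      have := hYf.fintype
      let e := Fintype.equivFin Y
      obtain ⟨z, hz⟩ := hfin (Fintype.card Y) (fun j => (e.symm j : ι)) fun j => hY (e.symm j).2
      refine ⟨z, ?_⟩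
      rintro _ ⟨p, hp, rfl⟩
      have := hz (e ⟨p, hp⟩)
      simp only [Equiv.symm_apply_apply] at this
      exact this)
  exact ⟨z, fun p hp => hz _ ⟨p, hp, rfl⟩⟩

/-- The signs of the coordinates of `y - x` are those given by `σ`. -/
def HasSign {m : ℕ} (σ : Fin m → Bool) (x y : Fin m → ℚ) : Prop :=
  ∀ i, (σ i = true ∧ x i < y i) ∨ (σ i = false ∧ y i < x i)

/-- No coordinate of a point in the tuple `e` separates `x` from the origin. -/
def NearZero {m n : ℕ} (e : Fin n → Fin m → ℚ) (x : Fin m → ℚ) : Prop :=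
  ∀ j i, (e j i < 0 → e j i < x i) ∧ (0 < e j i → x i < e j i)

/-- The tuple `(x, y, e₀, e₁, …)`. -/
def consPair {n : ℕ} {α : Type*} (x y : α) (e : Fin n → α) : Fin (n + 2) → α :=
  Fin.cons x (Fin.cons y e : Fin (n + 1) → α)

/-- Relative to `e`, the points `x` and `y` sit as the origin does, so only their mutual order,
which is the sign, remains to be compared. -/
theorem samePattern_consPair {m n : ℕ} {e : Fin n → Fin m → ℚ} (he : ∀ j i, e j i ≠ 0)
    {σ : Fin m → Bool} {x y x' y' : Fin m → ℚ} (h : HasSign σ x y) (h' : HasSign σ x' y')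
    (hx : NearZero e x) (hy : NearZero e y) (hx' : NearZero e x') (hy' : NearZero e y') :
    SamePattern (consPair x y e) (consPair x' y' e) := by
  have key : ∀ {x x' : Fin m → ℚ}, NearZero e x → NearZero e x' → ∀ j i,
      (x i < e j i ↔ x' i < e j i) ∧ (e j i < x i ↔ e j i < x' i) := by
    intro x x' hx hx' j i
    rcases lt_or_gt_of_ne (he j i) with hlt | hlt
    · have h1 := (hx j i).1 hlt
      have h2 := (hx' j i).1 hlt
      exact ⟨iff_of_false h1.not_gt h2.not_gt, iff_of_true h1 h2⟩
    · have h1 := (hx j i).2 hlt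
      have h2 := (hx' j i).2 hlt
      exact ⟨iff_of_true h1 h2, iff_of_false h1.not_gt h2.not_gt⟩
  intro i j k
  refine Fin.cases ?_ (fun j => Fin.cases ?_ (fun j => ?_) j) j <;>
    refine Fin.cases ?_ (fun k => Fin.cases ?_ (fun k => ?_) k) k <;>
    simp only [consPair, Fin.cons_zero, Fin.cons_succ, lt_self_iff_false]
  · rcases h i with ⟨hs, hl⟩ | ⟨hs, hl⟩ <;> rcases h' i with ⟨hs', hl'⟩ | ⟨hs', hl'⟩
    · exact iff_of_true hl hl'
    · simp [hs] at hs'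
    · simp [hs] at hs'
    · exact iff_of_false hl.not_gt hl'.not_gt
  · exact (key hx hx' k i).1
  · rcases h i with ⟨hs, hl⟩ | ⟨hs, hl⟩ <;> rcases h' i with ⟨hs', hl'⟩ | ⟨hs', hl'⟩
    · exact iff_of_false hl.not_gt hl'.not_gt
    · simp [hs] at hs'
    · simp [hs] at hs'
    · exact iff_of_true hl hl'
  · exact (key hy hy' k i).1
  · exact (key hx hx' j i).2
  · exact (key hy hy' j i).2

/-- The grid `b` is indiscernible over `B`. -/
def IsIndiscernibleGrid (L : FirstOrder.Language.{u, v}) [L.Structure M] (B : Set M) {m d : ℕ}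
    (b : (Fin m → ℚ) → Fin d → M) : Prop :=
  ∀ (n : ℕ) (u v : Fin n → Fin m → ℚ), SamePattern u v → ∀ R : Set (Fin n × Fin d → M),
    B.Definable L R → ((fun y => b (u y.1) y.2) ∈ R ↔ (fun y => b (v y.1) y.2) ∈ R)

/-- The instances of `D` cut the grid `b` along the `i`-th axis. -/
def CutsGrid {m d k : ℕ} (D : Set (Fin d ⊕ Fin k → M)) (b : (Fin m → ℚ) → Fin d → M)
    (i : Fin m) : Prop :=
  ∀ (n : ℕ) (u : Fin n → Fin m → ℚ) (ℓ : ℚ), (∀ j, u j i ≠ ℓ) →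
    ∃ z : Fin k → M, ∀ j, Sum.elim (b (u j)) z ∈ D ↔ u j i < ℓ

/-- Some relation over `B` and finitely many points of the grid with nonzero coordinates
distinguishes the pairs near the origin of sign `σ` from those of sign `τ`. -/
def SeparatesSigns (L : FirstOrder.Language.{u, v}) [L.Structure M] (B : Set M) {m d : ℕ}
    (b : (Fin m → ℚ) → Fin d → M) (σ τ : Fin m → Bool) : Prop :=
  ∃ (n : ℕ) (e : Fin n → Fin m → ℚ) (R : Set (Fin (n + 2) × Fin d → M)), (∀ j i, e j i ≠ 0) ∧
    B.Definable L R ∧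
    (∀ x y, NearZero e x → NearZero e y → HasSign σ x y →
      (fun q : Fin (n + 2) × Fin d => b (consPair x y e q.1) q.2) ∈ R) ∧
    (∀ x y, NearZero e x → NearZero e y → HasSign τ x y →
      (fun q : Fin (n + 2) × Fin d => b (consPair x y e q.1) q.2) ∉ R)

/-- By indiscernibility, membership in `R` depends only on the sign of the pair. A difference would
thus make `R` or its complement a separating relation. -/
theorem mem_iff_of_not_separatesSigns {B : Set M} {m d : ℕ} {b : (Fin m → ℚ) → Fin d → M}
    (hb : IsIndiscernibleGrid L B b) {σ τ : Fin m → Bool} (hns : ¬ SeparatesSigns L B b σ τ)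
    {n : ℕ} {e : Fin n → Fin m → ℚ} (he : ∀ j i, e j i ≠ 0) {x y x' y' : Fin m → ℚ}
    (hx : NearZero e x) (hy : NearZero e y) (hx' : NearZero e x') (hy' : NearZero e y')
    (h : HasSign σ x y) (h' : HasSign τ x' y') {R : Set (Fin (n + 2) × Fin d → M)}
    (hR : B.Definable L R) :
    (fun q : Fin (n + 2) × Fin d => b (consPair x y e q.1) q.2) ∈ R ↔
      (fun q : Fin (n + 2) × Fin d => b (consPair x' y' e q.1) q.2) ∈ R := by
  have aux : ∀ {R : Set (Fin (n + 2) × Fin d → M)}, B.Definable L R →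
      (fun q : Fin (n + 2) × Fin d => b (consPair x y e q.1) q.2) ∈ R →
      (fun q : Fin (n + 2) × Fin d => b (consPair x' y' e q.1) q.2) ∈ R := by
    intro R hR h1
    by_contra h2
    refine hns ⟨n, e, R, he, hR, fun x₁ y₁ hx₁ hy₁ hs => ?_, fun x₁ y₁ hx₁ hy₁ hs hmem => h2 ?_⟩
    · exact (hb _ _ _ (samePattern_consPair he h hs hx hy hx₁ hy₁) R hR).1 h1
    · exact (hb _ _ _ (samePattern_consPair he h' hs hx' hy' hx₁ hy₁) R hR).2 hmem
  refine ⟨aux hR, fun h2 => ?_⟩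
  by_contra h1
  exact aux hR.compl h1 h2

/-- The plane in `ℚ^m` whose points have coordinates `± p.1` along the axes where `σ` and `τ`
differ, and `± p.2` along the other axes, the signs being given by `σ`. -/
def planePoint {m : ℕ} (σ τ : Fin m → Bool) (p : ℚ × ℚ) : Fin m → ℚ := fun i =>
  (if σ i then 1 else -1) * (if σ i = τ i then p.2 else p.1)

theorem samePattern_planePoint {m : ℕ} (σ τ : Fin m → Bool) {ι : Type*} {p q : ι → ℚ × ℚ}
    (h1 : ∀ j k, (p j).1 < (p k).1 ↔ (q j).1 < (q k).1)
    (h2 : ∀ j k, (p j).2 < (p k).2 ↔ (q j).2 < (q k).2) :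
    SamePattern (fun j => planePoint σ τ (p j)) fun j => planePoint σ τ (q j) := by
  intro i j k
  have h1' := h1 k j
  have h2' := h2 k j
  specialize h1 j k
  specialize h2 j k
  unfold planePoint
  by_cases hσ : σ i = true <;> by_cases hτ : σ i = τ i <;>
    simp only [hσ, if_true, if_false, one_mul, neg_mul, neg_lt_neg_iff, Bool.false_eq_true] <;>
    simp only [hσ] at hτ <;> simp only [hτ, if_true, if_false] <;> assumption

end Separation

/-! ### Exchange of heights, and its conflict with NIP. -/

section Separation

variable {L : FirstOrder.Language.{u, v}} {M : Type w} [L.Structure M]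

theorem hasSign_planePoint {m : ℕ} {σ τ : Fin m → Bool} {s₁ s₂ t₁ t₂ : ℚ} (hs : s₁ < s₂)
    (ht : t₁ < t₂) (c : Fin m → ℚ) :
    HasSign σ (planePoint σ τ (s₁, t₁) - c) (planePoint σ τ (s₂, t₂) - c) := by
  intro i
  simp only [planePoint, Pi.sub_apply]
  cases hσ : σ i <;> cases hτ : τ i <;> simp [hs, ht]

/-- Exchanging heights reverses the direction of the first parameter only, which flips exactly the
axes where `σ` and `τ` differ. -/
theorem hasSign_planePoint_swap {m : ℕ} {σ τ : Fin m → Bool} {s₁ s₂ t₁ t₂ : ℚ} (hs : s₁ < s₂)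
    (ht : t₁ < t₂) (c : Fin m → ℚ) :
    HasSign τ (planePoint σ τ (s₂, t₁) - c) (planePoint σ τ (s₁, t₂) - c) := by
  intro i
  simp only [planePoint, Pi.sub_apply]
  cases hσ : σ i <;> cases hτ : τ i <;> simp [hs, ht]

theorem nearZero_planePoint {m n : ℕ} {σ τ : Fin m → Bool} {s₁ s₂ t₁ t₂ : ℚ} (hs : s₁ ≤ s₂)
    (ht : t₁ ≤ t₂) {p : Fin n → ℚ × ℚ} (hp : ∀ j, ((p j).1 < s₁ ∨ s₂ < (p j).1) ∧
      ((p j).2 < t₁ ∨ t₂ < (p j).2)) {x : ℚ × ℚ} (hx1 : s₁ ≤ x.1 ∧ x.1 ≤ s₂)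
    (hx2 : t₁ ≤ x.2 ∧ x.2 ≤ t₂) :
    NearZero (fun j => planePoint σ τ (p j) - planePoint σ τ (s₁, t₁))
      (planePoint σ τ x - planePoint σ τ (s₁, t₁)) := by
  intro j i
  obtain ⟨h1, h2⟩ := hp j
  simp only [planePoint, Pi.sub_apply]
  split_ifs with h h'
  · refine ⟨fun h => ?_, fun h => ?_⟩ <;> rcases h2 with h2 | h2 <;> linarith
  · refine ⟨fun h => ?_, fun h => ?_⟩ <;> rcases h1 with h1 | h1 <;> linarith
  · refine ⟨fun h => ?_, fun h => ?_⟩ <;> rcases h2 with h2 | h2 <;> linarith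
  · refine ⟨fun h => ?_, fun h => ?_⟩ <;> rcases h1 with h1 | h1 <;> linarith

theorem planePoint_sub_ne_zero {m : ℕ} {σ τ : Fin m → Bool} {s₁ s₂ t₁ t₂ : ℚ} (hs : s₁ ≤ s₂)
    (ht : t₁ ≤ t₂) {p : ℚ × ℚ} (hp : (p.1 < s₁ ∨ s₂ < p.1) ∧ (p.2 < t₁ ∨ t₂ < p.2)) (i : Fin m) :
    (planePoint σ τ p - planePoint σ τ (s₁, t₁)) i ≠ 0 := by
  obtain ⟨h1, h2⟩ := hp
  simp only [planePoint, Pi.sub_apply]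
  intro h
  split_ifs at h
  · rcases h2 with h2 | h2 <;> linarith
  · rcases h1 with h1 | h1 <;> linarith
  · rcases h2 with h2 | h2 <;> linarith
  · rcases h1 with h1 | h1 <;> linarith

theorem samePattern_sub {m : ℕ} {ι : Type*} (u : ι → Fin m → ℚ) (c : Fin m → ℚ) :
    SamePattern u fun j => u j - c := fun i j k => by simp

/-- If no relation separates the signs `σ` and `τ`, then the heights of two points of the plane can
be exchanged. -/
theorem mem_iff_swap {B : Set M} {m d : ℕ} {b : (Fin m → ℚ) → Fin d → M}
    (hb : IsIndiscernibleGrid L B b) {σ τ : Fin m → Bool} (hns : ¬ SeparatesSigns L B b σ τ)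
    {s₁ s₂ t₁ t₂ : ℚ} (hs : s₁ < s₂) (ht : t₁ < t₂) {n : ℕ} {p : Fin n → ℚ × ℚ}
    (hp : ∀ j, ((p j).1 < s₁ ∨ s₂ < (p j).1) ∧ ((p j).2 < t₁ ∨ t₂ < (p j).2))
    {R : Set (Fin (n + 2) × Fin d → M)} (hR : B.Definable L R) :
    (fun q : Fin (n + 2) × Fin d =>
        b (planePoint σ τ (consPair (s₁, t₁) (s₂, t₂) p q.1)) q.2) ∈ R ↔
      (fun q : Fin (n + 2) × Fin d =>
        b (planePoint σ τ (consPair (s₂, t₁) (s₁, t₂) p q.1)) q.2) ∈ R := by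
  -- Translating a corner of the rectangle to the origin preserves patterns. The side points, being
  -- off both strips, get nonzero coordinates that do not separate any corner from the origin.
  let c : Fin m → ℚ := planePoint σ τ (s₁, t₁)
  have hc : ∀ (x y : ℚ × ℚ) (j : Fin (n + 2)), planePoint σ τ (consPair x y p j) - c =
      consPair (planePoint σ τ x - c) (planePoint σ τ y - c)
        (fun j => planePoint σ τ (p j) - c) j := by
    intro x y j
    refine Fin.cases ?_ (fun j => Fin.cases ?_ (fun j => ?_) j) j <;> rfl
  have h1 := hb (n + 2) _ _ (samePattern_sub
    (fun j => planePoint σ τ (consPair (s₁, t₁) (s₂, t₂) p j)) c) R hR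
  have h2 := hb (n + 2) _ _ (samePattern_sub
    (fun j => planePoint σ τ (consPair (s₂, t₁) (s₁, t₂) p j)) c) R hR
  simp only [hc] at h1 h2
  refine h1.trans (Iff.trans ?_ h2.symm)
  refine mem_iff_of_not_separatesSigns hb hns (fun j i => planePoint_sub_ne_zero hs.le ht.le (hp j) i)
    ?_ ?_ ?_ ?_ (hasSign_planePoint hs ht c) (hasSign_planePoint_swap hs ht c) hR
  all_goals
    refine nearZero_planePoint hs.le ht.le hp ⟨?_, ?_⟩ ⟨?_, ?_⟩ <;> simp only [le_refl, hs.le, ht.le]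

/-- A set with finite VC-dimension does not split many boxes with disjoint projections. -/
theorem exists_shattered_of_isSplitBy {B : Set M} {m d k : ℕ} {b : (Fin m → ℚ) → Fin d → M}
    (hb : IsIndiscernibleGrid L B b) (σ τ : Fin m → Bool) {D : Set (Fin d ⊕ Fin k → M)}
    (hD : B.Definable L D) {z : Fin k → M} {l : List ((ℚ × ℚ) × (ℚ × ℚ))}
    (hl : IsSplitBy {p | Sum.elim (b (planePoint σ τ p)) z ∈ D} l) {n : ℕ} (hn : n ≤ l.length) :
    ∃ a : Fin n → Fin d → M, ∀ s : Set (Fin n), ∃ z : Fin k → M,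
      ∀ i, Sum.elim (a i) z ∈ D ↔ i ∈ s := by
  classical
  let P : Fin n → (ℚ × ℚ) × (ℚ × ℚ) := fun j => l.get (Fin.castLE hn j)
  have hsep : ∀ j j', j < j' → SepPairs (P j) (P j') := fun j j' hjj =>
    List.pairwise_iff_get.1 hl.1 _ _ hjj
  have hmem : ∀ j, Sum.elim (b (planePoint σ τ (P j).1)) z ∈ D ∧
      Sum.elim (b (planePoint σ τ (P j).2)) z ∉ D := fun j => hl.2 _ (List.get_mem l _)
  refine ⟨fun j => b (planePoint σ τ (P j).1), fun s => ?_⟩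
  -- As the projections are disjoint, either choice in each box gives the same coordinatewise order.
  -- Indiscernibility then moves the pattern `s` to the fixed points `(P j).1`.
  let p : Fin n → ℚ × ℚ := fun j => if j ∈ s then (P j).1 else (P j).2
  have hp : ∀ j, p j = (P j).1 ∨ p j = (P j).2 := fun j => by
    by_cases h : j ∈ s
    · exact Or.inl (if_pos h)
    · exact Or.inr (if_neg h)
  have key : ∀ j j', ((p j).1 < (p j').1 ↔ (P j).1.1 < (P j').1.1) ∧
      ((p j).2 < (p j').2 ↔ (P j).1.2 < (P j').1.2) := by
    intro j j'
    rcases lt_trichotomy j j' with h | rfl | h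
    · obtain ⟨h1, h2⟩ := hsep j j' h
      constructor
      · rcases hp j with e | e <;> rcases hp j' with e' | e' <;> rw [e, e'] <;>
          rcases h1 with h1 | h1 <;> first | exact iff_of_true (by tauto) (by tauto) |
            exact iff_of_false (not_lt.2 (by linarith)) (not_lt.2 (by linarith))
      · rcases hp j with e | e <;> rcases hp j' with e' | e' <;> rw [e, e'] <;>
          rcases h2 with h2 | h2 <;> first | exact iff_of_true (by tauto) (by tauto) |
            exact iff_of_false (not_lt.2 (by linarith)) (not_lt.2 (by linarith))
    · simp
    · obtain ⟨h1, h2⟩ := hsep j' j h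
      constructor
      · rcases hp j with e | e <;> rcases hp j' with e' | e' <;> rw [e, e'] <;>
          rcases h1 with h1 | h1 <;> first | exact iff_of_true (by tauto) (by tauto) |
            exact iff_of_false (not_lt.2 (by linarith)) (not_lt.2 (by linarith))
      · rcases hp j with e | e <;> rcases hp j' with e' | e' <;> rw [e, e'] <;>
          rcases h2 with h2 | h2 <;> first | exact iff_of_true (by tauto) (by tauto) |
            exact iff_of_false (not_lt.2 (by linarith)) (not_lt.2 (by linarith))
  have hpat := samePattern_planePoint σ τ (p := p) (q := fun j => (P j).1)
    (fun j j' => (key j j').1) fun j j' => (key j j').2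
  have := (hb n _ _ hpat _ (definable_exists_pattern hD fun j => j ∈ s)).1 ⟨z, fun j => by
    by_cases h : j ∈ s
    · simp only [p, h, if_true, iff_true]
      exact (hmem j).1
    · simp only [p, h, if_false, iff_false]
      exact (hmem j).2⟩
  exact this

/-- In a grid that is cut along the `i`-th axis by the instances of a relation with finite
VC-dimension, the signs of pairs of points that differ along that axis are separated. -/
theorem separatesSigns {κ : Cardinal.{w}} (hκ : ℵ_ 1 ≤ κ) (hM : IsSaturated L M κ)
    {B : Set M} (hB : #B < κ) {m d k : ℕ} {b : (Fin m → ℚ) → Fin d → M}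
    (hb : IsIndiscernibleGrid L B b) {D : Set (Fin d ⊕ Fin k → M)} (hD : B.Definable L D)
    (hvc : ∃ n : ℕ, ¬ ∃ a : Fin n → Fin d → M, ∀ s : Set (Fin n), ∃ z : Fin k → M,
      ∀ i, Sum.elim (a i) z ∈ D ↔ i ∈ s)
    {i : Fin m} (hcut : CutsGrid D b i) {σ τ : Fin m → Bool} (hσ : σ i = true)
    (hτ : τ i = false) : SeparatesSigns L B b σ τ := by
  classical
  by_contra hns
  obtain ⟨n, hn⟩ := hvc
  let β : ℚ × ℚ → Fin d → M := fun p => b (planePoint σ τ p)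
  obtain ⟨S, ⟨z, rfl⟩, l, hl, hln⟩ := exists_isSplitBy_of_swap
    (Set.range fun z : Fin k → M => {p | Sum.elim (β p) z ∈ D}) (k := n) (by
      rintro _ ⟨z, rfl⟩ s₁ s₂ t₁ t₂ hs ht
      let off : Set (ℚ × ℚ) := {p | (p.1 < s₁ ∨ s₂ < p.1) ∧ (p.2 < t₁ ∨ t₂ < p.2)}
      have ho : (s₁ - 1, t₁ - 1) ∈ off :=
        ⟨Or.inl (by simp), Or.inl (by simp)⟩
      have h1 : (s₂, t₁) ∉ off := fun h => by
        rcases h.1 with h | h <;> simp only at h <;> linarith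
      have h2 : (s₁, t₂) ∉ off := fun h => by
        rcases h.1 with h | h <;> simp only at h <;> linarith
      let A : Set (ℚ × ℚ) := {p | Sum.elim (β p) z ∈ D}
      let pat : Set (ℚ × ℚ) := {p | (p ∈ off ∧ p ∈ A) ∨ (p = (s₂, t₁) ∧ (s₁, t₁) ∈ A) ∨
        (p = (s₁, t₂) ∧ (s₂, t₂) ∈ A)}
      have hpat1 : (s₂, t₁) ∈ pat ↔ (s₁, t₁) ∈ A := by
        simp only [pat, Set.mem_ofPred_eq, h1, false_and, true_and, false_or, Prod.mk.injEq, hs.ne',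
          or_false]
      have hpat2 : (s₁, t₂) ∈ pat ↔ (s₂, t₂) ∈ A := by
        simp only [pat, Set.mem_ofPred_eq, h2, false_and, true_and, false_or, Prod.mk.injEq, hs.ne]
      have hpat3 : ∀ p ∈ off, (p ∈ pat ↔ p ∈ A) := by
        intro p hp
        have e1 : p ≠ (s₂, t₁) := fun e => h1 (e ▸ hp)
        have e2 : p ≠ (s₁, t₂) := fun e => h2 (e ▸ hp)
        simp only [pat, Set.mem_ofPred_eq, hp, true_and, e1, e2, false_and, or_false]
      obtain ⟨z', hz'⟩ := hM.exists_trace hκ hB hD β (insert (s₂, t₁) (insert (s₁, t₂) off)) pat (by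
        intro n p hp
        -- The exchange needs all side points off the strips. Exchanged corners in the list become a
        -- dummy point here and are handled by positions `0` and `1`.
        let p' : Fin n → ℚ × ℚ := fun j => if p j ∈ off then p j else (s₁ - 1, t₁ - 1)
        have hp' : ∀ j, p' j ∈ off := fun j => by
          by_cases h : p j ∈ off
          · simp only [p', h, if_true]
          · simp only [p', h, if_false, ho]
        let ε : Fin (n + 2) → Prop := fun j => consPair (s₁, t₁) (s₂, t₂) p' j ∈ A
        obtain ⟨z', hz'⟩ := (mem_iff_swap hb hns hs ht hp' (definable_exists_pattern hD ε)).1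
          ⟨z, fun j => Iff.rfl⟩
        refine ⟨z', fun j => ?_⟩
        rcases hp j with h | h | h
        · rw [h, hpat1]
          exact hz' 0
        · rw [h, hpat2]
          exact hz' 1
        · rw [hpat3 _ h]
          have := hz' j.succ.succ
          have e : p' j = p j := if_pos h
          simpa only [ε, consPair, Fin.cons_succ, e] using this)
      refine ⟨_, ⟨z', rfl⟩, fun p hp1 hp2 => ?_, ?_, ?_⟩
      · exact (hz' p (Or.inr (Or.inr ⟨hp1, hp2⟩))).trans (hpat3 p ⟨hp1, hp2⟩)
      · exact (hz' _ (Or.inl rfl)).trans hpat1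
      · exact (hz' _ (Or.inr (Or.inl rfl))).trans hpat2)
    (by
      -- As `σ` and `τ` differ at `i`, the cut at `0` along this axis traces the required
      -- half-plane.
      have hi : ∀ p, planePoint σ τ p i = p.1 := fun p => by simp [planePoint, hσ, hτ]
      obtain ⟨z, hz⟩ := hM.exists_trace hκ hB hD β {p | p.1 ≠ 0} {p | p.1 < 0} (by
        intro n p hp
        obtain ⟨z, hz⟩ := hcut n (fun j => planePoint σ τ (p j)) 0 fun j => by
          rw [hi]
          exact hp j
        refine ⟨z, fun j => ?_⟩
        have := hz j
        rw [hi] at this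
        exact this)
      refine ⟨_, ⟨z, rfl⟩, fun p => ⟨fun h => (hz p h.ne).2 h, fun h h' => ?_⟩⟩
      exact h.not_gt ((hz p h.ne').1 h'))
  exact hn (exists_shattered_of_isSplitBy hb σ τ hD hl hln)

end Separation

/-! ### Defining the orders near the origin. -/

section OrderFormulas

variable {L : FirstOrder.Language.{u, v}} {M : Type w} [L.Structure M]

theorem exists_pos_le_of_finite {ι : Type*} [Finite ι] (f : ι → ℚ) (hf : ∀ i, 0 < f i) :
    ∃ ε : ℚ, 0 < ε ∧ ∀ i, ε ≤ f i := by
  cases nonempty_fintype ι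
  rcases isEmpty_or_nonempty ι with h | h
  · exact ⟨1, one_pos, fun i => h.elim i⟩
  · obtain ⟨i, hi⟩ := Finite.exists_min f
    exact ⟨f i, hf i, hi⟩

theorem nearZero_of_abs_lt {m n : ℕ} {e : Fin n → Fin m → ℚ} {ε : ℚ} (he : ∀ j i, ε ≤ |e j i|)
    {x : Fin m → ℚ} (hx : ∀ i, |x i| < ε) : NearZero e x := by
  intro j i
  have h := abs_lt.1 ((hx i).trans_le (he j i))
  refine ⟨fun hlt => ?_, fun hlt => ?_⟩
  · rw [abs_of_neg hlt, neg_neg] at h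
    exact h.1
  · rw [abs_of_pos hlt] at h
    exact h.2

theorem definable_consPair {B : Set M} {n d : ℕ} {R : Set (Fin (n + 2) × Fin d → M)}
    (hR : B.Definable L R) (e : Fin n → Fin d → M) :
    (Set.univ : Set M).Definable L {w : Fin 2 × Fin d → M |
      (fun q : Fin (n + 2) × Fin d =>
        consPair (fun p => w (0, p)) (fun p => w (1, p)) e q.1 q.2) ∈ R} := by
  let f : Fin (n + 2) × Fin d → (Fin 2 × Fin d) ⊕ (Fin n × Fin d) := fun q =>
    consPair (Sum.inl (0, q.2)) (Sum.inl (1, q.2)) (fun j => Sum.inr (j, q.2)) q.1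
  have h := definable_fiber (hR.preimage_comp f) (fun q : Fin n × Fin d => e q.1 q.2)
    (Set.subset_univ B) fun _ => Set.mem_univ _
  convert! h using 1
  ext w
  simp only [Set.mem_ofPred_eq, Set.mem_preimage]
  refine iff_of_eq (congrArg (· ∈ R) ?_)
  funext ⟨j, q⟩
  refine Fin.cases ?_ (fun j => Fin.cases ?_ (fun j => ?_) j) j <;> rfl

theorem definable_ne_pair (d : ℕ) :
    (Set.univ : Set M).Definable L {w : Fin 2 × Fin d → M |
      (fun p => w (0, p)) ≠ fun p => w (1, p)} := by
  have h : (Set.univ : Set M).Definable L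
      (⋂ p : Fin d, {w : Fin 2 × Fin d → M | w (0, p) = w (1, p)}) :=
    Set.definable_iInter_of_finite fun p =>
      ⟨(Term.var (0, p)).equal (Term.var (1, p)), by ext; simp⟩
  convert! h.compl using 1
  ext w
  simp [funext_iff]

/-- In an indiscernible grid with finite VC-dimension cut along each axis, the order of the points
along each axis is definable near the origin. -/
theorem exists_order_formula {κ : Cardinal.{w}} (hκ : ℵ_ 1 ≤ κ) (hM : IsSaturated L M κ)
    {B : Set M} (hB : #B < κ) {m d : ℕ} {k : Fin m → ℕ} {b : (Fin m → ℚ) → Fin d → M}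
    (hb : IsIndiscernibleGrid L B b) {D : ∀ i, Set (Fin d ⊕ Fin (k i) → M)}
    (hD : ∀ i, B.Definable L (D i))
    (hvc : ∀ i, ∃ n : ℕ, ¬ ∃ a : Fin n → Fin d → M, ∀ s : Set (Fin n), ∃ z : Fin (k i) → M,
      ∀ j, Sum.elim (a j) z ∈ D i ↔ j ∈ s)
    (hcut : ∀ i, CutsGrid (D i) b i) :
    ∃ ε : ℚ, 0 < ε ∧ ∀ i, ∃ φ : L[[M]].Formula (Fin 2 × Fin d), ∀ x y : Fin m → ℚ,
      (∀ i, |x i| < ε) → (∀ i, |y i| < ε) → (x = y ∨ ∀ i, x i ≠ y i) →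
      (φ.Realize (fun q => b (![x, y] q.1) q.2) ↔ x i < y i) := by
  classical
  have hsep : ∀ t : {t : Fin m × (Fin m → Bool) × (Fin m → Bool) //
      t.2.1 t.1 = true ∧ t.2.2 t.1 = false}, SeparatesSigns L B b t.1.2.1 t.1.2.2 := fun t =>
    separatesSigns hκ hM hB hb (hD t.1.1) (hvc t.1.1) (hcut t.1.1) t.2.1 t.2.2
  choose n e R he hR hpos hneg using hsep
  obtain ⟨ε, hε, hle⟩ := exists_pos_le_of_finite
    (fun x : (Σ t, Fin (n t)) × Fin m => |e x.1.1 x.1.2 x.2|) fun x => abs_pos.2 (he _ _ _)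
  refine ⟨ε, hε, fun i => ?_⟩
  let W : {t : Fin m × (Fin m → Bool) × (Fin m → Bool) //
      t.2.1 t.1 = true ∧ t.2.2 t.1 = false} → Set (Fin 2 × Fin d → M) := fun t =>
    {w | (fun q : Fin (n t + 2) × Fin d => consPair (fun p => w (0, p)) (fun p => w (1, p))
      (fun j => b (e t j)) q.1 q.2) ∈ R t}
  -- For a pair of sign `ρ`: if `ρ i` is true, the disjunct `σ = ρ` holds; if not, the conjunct `τ =
  -- ρ` refutes every disjunct. Equal points have no sign and are excluded separately.
  have hdef : (Set.univ : Set M).Definable L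
      ({w : Fin 2 × Fin d → M | (fun p => w (0, p)) ≠ fun p => w (1, p)} ∩
        ⋃ σ : {σ : Fin m → Bool // σ i = true}, ⋂ τ : {τ : Fin m → Bool // τ i = false},
          W ⟨(i, σ, τ), σ.2, τ.2⟩) :=
    (definable_ne_pair d).inter (Set.definable_iUnion_of_finite fun σ =>
      Set.definable_iInter_of_finite fun τ => definable_consPair (hR _) _)
  obtain ⟨φ, hφ⟩ := exists_formula_of_definable hdef
  refine ⟨φ, fun x y hx hy hxy => ?_⟩
  rw [hφ]
  rcases hxy with rfl | hxy
  · refine iff_of_false (fun h => h.1 rfl) (lt_irrefl _)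
  let ρ : Fin m → Bool := fun i => decide (x i < y i)
  have hρ : HasSign ρ x y := by
    intro i
    rcases lt_or_gt_of_ne (hxy i) with h | h
    · exact Or.inl ⟨decide_eq_true h, h⟩
    · exact Or.inr ⟨decide_eq_false h.not_gt, h⟩
  have hnx : ∀ t, NearZero (e t) x := fun t =>
    nearZero_of_abs_lt (fun j i => hle (⟨t, j⟩, i)) hx
  have hny : ∀ t, NearZero (e t) y := fun t =>
    nearZero_of_abs_lt (fun j i => hle (⟨t, j⟩, i)) hy
  have hW : ∀ t, (fun q => b (![x, y] q.1) q.2) ∈ W t ↔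
      (fun q : Fin (n t + 2) × Fin d => b (consPair x y (e t) q.1) q.2) ∈ R t := by
    intro t
    refine iff_of_eq (congrArg (· ∈ R t) ?_)
    funext ⟨j, q⟩
    refine Fin.cases ?_ (fun j => Fin.cases ?_ (fun j => ?_) j) j <;> rfl
  constructor
  · rintro ⟨-, h⟩
    by_contra hlt
    obtain ⟨σ, hσ⟩ := Set.mem_iUnion.1 h
    have := Set.mem_iInter.1 hσ ⟨ρ, decide_eq_false hlt⟩
    rw [hW] at this
    exact hneg _ x y (hnx _) (hny _) hρ this
  · intro hlt
    refine ⟨fun h => ?_, Set.mem_iUnion.2 ⟨⟨ρ, decide_eq_true hlt⟩, Set.mem_iInter.2 fun τ => ?_⟩⟩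
    -- A cut strictly between `x i` and `y i` shows that `b x` and `b y` are distinct tuples.
    · obtain ⟨ℓ, h1, h2⟩ := exists_between hlt
      obtain ⟨z, hz⟩ := hcut i 2 ![x, y] ℓ (by
        intro j
        refine Fin.cases ?_ (fun j => ?_) j
        · exact h1.ne
        · rw [Subsingleton.elim j 0]
          exact h2.ne')
      have hbe : b x = b y := h
      have e0 := hz 0
      have e1 := hz 1
      simp only [Matrix.cons_val_zero, Matrix.cons_val_one] at e0 e1
      rw [hbe, e1] at e0
      exact h2.not_gt (e0.2 h1)
    · rw [hW]
      exact hpos _ x y (hnx _) (hny _) hρ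

end OrderFormulas

/-! ### From IRD-patterns to grids with definable orders. -/

section FromPattern

variable {L : FirstOrder.Language.{u, v}} {M : Type w} [L.Structure M]

/-- A realization of each of the types in an IRD-pattern. -/
theorem exists_realization_of_pattern {κ : Cardinal.{w}} (hκ : ℵ_ 1 ≤ κ) (hM : IsSaturated L M κ)
    {A B : Set M} (hB : #B < κ) (hAB : A ⊆ B) {d m : ℕ} {π : Set (L[[A]].Formula (Fin d))}
    {k : Fin m → ℕ} {φ : ∀ i, L[[M]].Formula (Fin d ⊕ Fin (k i))}
    (hφ : ∀ i, B.Definable L {v | (φ i).Realize v}) {c : ∀ i, ℕ → Fin (k i) → M} {g : Fin m → ℕ}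
    (hfs : FinitelySatisfiable M (liftParams π ∪
      {ψ | ∃ (i : Fin m) (j : ℕ), ψ = formulaIff (plugIn (φ i) (c i j)) (g i < j)})) :
    ∃ a : Fin d → M, a ∈ realizations M π ∧
      ∀ i j, (φ i).Realize (Sum.elim a (c i j)) ↔ g i < j := by
  let C : Set M := B ∪ Set.range fun x : (Σ i, Fin (k i)) × ℕ => c x.1.1 x.2 x.1.2
  have hC : #C < κ := mk_union_countable_lt hκ hB (Set.countable_range _)
  obtain ⟨a, ha⟩ := hM.sInter_nonempty hκ hC
    (𝓢 := (fun ψ : L[[M]].Formula (Fin d) => {x : Fin d → M | ψ.Realize x}) '' (liftParams π ∪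
      {ψ | ∃ (i : Fin m) (j : ℕ), ψ = formulaIff (plugIn (φ i) (c i j)) (g i < j)})) (by
      rintro _ ⟨ψ, ⟨χ, hχ, rfl⟩ | ⟨i, j, rfl⟩, rfl⟩
      · have h : A.Definable L {x : Fin d → M | χ.Realize x} := ⟨χ, rfl⟩
        simp only [realize_onFormula_val]
        exact h.mono (hAB.trans Set.subset_union_left)
      · have h : C.Definable L {x : Fin d → M | (φ i).Realize (Sum.elim x (c i j))} :=
          definable_fiber (hφ i) (c i j) Set.subset_union_left
            fun q => Or.inr ⟨(⟨i, q⟩, j), rfl⟩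
        simp only [realize_formulaIff, realize_plugIn]
        by_cases hg : g i < j
        · simp only [hg, iff_true]
          exact h
        · simp only [hg, iff_false]
          exact h.compl) (by
      intro T hT hTf
      obtain ⟨F, hF, hFf, rfl⟩ := hTf.exists_subset_finite_image_eq hT
      obtain ⟨a, ha⟩ := hfs F hF hFf
      refine ⟨a, ?_⟩
      rintro _ ⟨ψ, hψ, rfl⟩
      exact ha ψ hψ)
  refine ⟨a, fun χ hχ => ?_, fun i j => ?_⟩
  · exact (realize_onFormula_val χ a).1 (ha _ ⟨_, Or.inl ⟨χ, hχ, rfl⟩, rfl⟩)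
  · have : (formulaIff (plugIn (φ i) (c i j)) (g i < j)).Realize a :=
      ha _ ⟨_, Or.inr ⟨i, j, rfl⟩, rfl⟩
    rwa [realize_formulaIff, realize_plugIn] at this

/-- In a theory with NIP, an IRD-pattern of depth `m` in `π` gives rise to a grid of realizations
of `π` on which the orders along the `m` axes are definable near the origin. -/
theorem HasIRDPattern.exists_grid {T : L.Theory} (hNIP : IsNIP.{u, v, w} T) [Nonempty M] [M ⊨ T]
    {κ : Cardinal.{w}} (hκ : ℵ_ 1 ≤ κ) (hM : IsSaturated L M κ) {A : Set M} (hA : #A < κ)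
    {d m : ℕ} {π : Set (L[[A]].Formula (Fin d))} (h : HasIRDPattern π m) :
    ∃ b : (Fin m → ℚ) → Fin d → M, (∀ g, b g ∈ realizations M π) ∧
      ∃ ε : ℚ, 0 < ε ∧ ∀ i, ∃ φ : L[[M]].Formula (Fin 2 × Fin d), ∀ x y : Fin m → ℚ,
        (∀ i, |x i| < ε) → (∀ i, |y i| < ε) → (x = y ∨ ∀ i, x i ≠ y i) →
        (φ.Realize (fun q => b (![x, y] q.1) q.2) ↔ x i < y i) := by
  classical
  obtain ⟨k, φ, c, hfs⟩ := h
  choose P _ hP using fun i =>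
    Set.definable_iff_finitely_definable.1 (definable_setOf_realize (φ i))
  -- The tuples `c i j` need not be included: the cut property quantifies over them existentially.
  let B : Set M := A ∪ ⋃ i, (P i : Set M)
  have hB : #B < κ := mk_union_countable_lt hκ hA
    (Set.countable_iUnion fun i => (P i).finite_toSet.countable)
  have hD : ∀ i, B.Definable L {v | (φ i).Realize v} := fun i =>
    (hP i).mono ((Set.subset_iUnion (fun i => (P i : Set M)) i).trans Set.subset_union_right)
  choose a haπ haφ using fun g : Fin m → ℕ =>
    exists_realization_of_pattern hκ hM hB Set.subset_union_left hD (hfs g)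
  obtain ⟨b, hb, htr⟩ := exists_indiscernible_grid hκ hM hB a
  refine ⟨b, fun g χ hχ => ?_, exists_order_formula hκ hM hB hb hD
    (fun i => hNIP.exists_not_shattered (definable_setOf_realize (φ i))) fun i n u ℓ hℓ => ?_⟩
  · have h : A.Definable L {x : Fin d → M | χ.Realize x} := ⟨χ, rfl⟩
    exact htr 1 (fun _ => g) _ ((h.preimage_comp fun q : Fin d => ((0 : Fin 1), q)).mono
      Set.subset_union_left) fun g' _ => haπ (g' 0) χ hχ
  · refine htr n u _ (definable_exists_pattern (hD i) fun j => u j i < ℓ) fun g hg => ?_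
    -- The least threshold above all indices on the lower side; if there are none it is `0`, and no
    -- index lies below it.
    let N : ℕ := (Finset.univ.filter fun j => u j i < ℓ).sup fun j => g j i + 1
    refine ⟨c i N, fun j => (haφ (g j) i N).trans ⟨fun hj => ?_, fun hj => ?_⟩⟩
    · by_contra hlt
      have hlt' : ℓ < u j i := lt_of_le_of_ne (not_lt.1 hlt) (hℓ j).symm
      refine hj.not_ge (Finset.sup_le fun j' hj' => ?_)
      exact hg i j' j ((Finset.mem_filter.1 hj').2.trans hlt')
    · exact Finset.le_sup (f := fun j => g j i + 1)
        (Finset.mem_filter.2 ⟨Finset.mem_univ j, hj⟩)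

end FromPattern

/-! ### Sets with several linear orders. -/

section MultiOrders

variable {m : ℕ}

/-- The structure on `X` whose `i`-th copy of the order symbol is interpreted as `r i`. -/
@[reducible] def ordStructure {X : Type} (r : Fin m → X → X → Prop) :
    (copies binLang m).Structure X where
  funMap f := isEmptyElim f
  RelMap R x := match R with
    | (i, BinRel.lt) => r i (x 0) (x 1)

/-- The `i`-th order symbol. -/
def ltSym (i : Fin m) : (copies binLang m).Relations 2 := (i, BinRel.lt)

/-- The interpretation of the `i`-th order symbol. -/
def ordRel {X : Type} [(copies binLang m).Structure X] (i : Fin m) (a b : X) : Prop :=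
  Structure.RelMap (ltSym i) ![a, b]

/-- Each of the `m` relations of `X` is a strict linear order. -/
structure IsMultiOrder (m : ℕ) (X : Type) [(copies binLang m).Structure X] : Prop where
  irrefl : ∀ (i : Fin m) (a : X), ¬ ordRel i a a
  trans : ∀ (i : Fin m) (a b c : X), ordRel i a b → ordRel i b c → ordRel i a c
  total : ∀ (i : Fin m) (a b : X), a ≠ b → ordRel i a b ∨ ordRel i b a

instance : IsEmpty (copies binLang m).Constants :=
  inferInstanceAs (IsEmpty Empty)

instance : IsEmpty ((copies binLang m).Relations 0) :=
  ⟨fun R => nomatch R.2⟩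

theorem relMap_iff_ordRel {X : Type} [(copies binLang m).Structure X] (i : Fin m)
    (x : Fin 2 → X) :
    Structure.RelMap (ltSym i) x ↔
      ordRel i (x 0) (x 1) := by
  have : x = ![x 0, x 1] := by
    ext j
    fin_cases j <;> rfl
  rw [ordRel, ← this]

/-- An isomorphism onto its image for all orders is an embedding, if there is some order. -/
def multiOrderEmbedding {X Y : Type} [(copies binLang m).Structure X]
    [(copies binLang m).Structure Y] (hm : 0 < m) (hX : IsMultiOrder m X)
    (hY : IsMultiOrder m Y) (f : X → Y)
    (hf : ∀ (i : Fin m) a b, ordRel i (f a) (f b) ↔ ordRel i a b) : X ↪[copies binLang m] Y where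
  toFun := f
  inj' a b hab := by
    by_contra hne
    rcases hX.total ⟨0, hm⟩ a b hne with h | h
    · rw [← hf, hab] at h
      exact hY.irrefl _ _ h
    · rw [← hf, hab] at h
      exact hY.irrefl _ _ h
  map_fun' g := isEmptyElim g
  map_rel' R x := by
    obtain ⟨i, R⟩ := R
    cases R
    exact (relMap_iff_ordRel i _).trans ((hf i _ _).trans (relMap_iff_ordRel i x).symm)

theorem ordRel_map {X Y : Type} [(copies binLang m).Structure X]
    [(copies binLang m).Structure Y] (f : X ↪[copies binLang m] Y) (i : Fin m) (a b : X) :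
    ordRel i (f a) (f b) ↔ ordRel i a b :=
  (relMap_iff_ordRel i (f ∘ ![a, b])).symm.trans (f.map_rel (ltSym i) ![a, b])

theorem IsMultiOrder.of_embedding {X Y : Type} [(copies binLang m).Structure X]
    [(copies binLang m).Structure Y] (hY : IsMultiOrder m Y) (f : X ↪[copies binLang m] Y) :
    IsMultiOrder m X where
  irrefl i a h := hY.irrefl i (f a) ((ordRel_map f i a a).2 h)
  trans i a b c hab hbc := (ordRel_map f i a c).1 <|
    hY.trans i _ (f b) _ ((ordRel_map f i a b).2 hab) ((ordRel_map f i b c).2 hbc)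
  total i a b hab := by
    rw [← ordRel_map f, ← ordRel_map f]
    exact hY.total i _ _ (f.injective.ne hab)

/-- A structure defined by injective coordinates in a linear order is a multi-order. -/
theorem isMultiOrder_of_coord {X : Type} {O : Type*} [LinearOrder O] (c : X → Fin m → O)
    (hc : ∀ i, Function.Injective fun x => c x i) :
    @IsMultiOrder m X (ordStructure fun i a b => c a i < c b i) :=
  letI := ordStructure (m := m) fun i a b => c a i < c b i
  { irrefl := fun i a => lt_irrefl (c a i)
    trans := fun i a b d => lt_trans (a := c a i) (b := c b i) (c := c d i)
    total := fun i _ _ hab => lt_or_gt_of_ne ((hc i).ne hab) }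

theorem isMultiOrder_iff_reduct (X : Type) [(copies binLang m).Structure X] [Finite X] :
    IsMultiOrder m X ↔ (⟨X, ‹_›⟩ : Bundled (copies binLang m).Structure) ∈ starPow LO m := by
  constructor
  · refine fun h => ⟨‹_›, fun i => ⟨‹_›, h.irrefl i, h.trans i, fun a b hab => ?_⟩⟩
    rcases h.total i a b hab with h' | h'
    · exact Or.inl ⟨h', fun h'' => h.irrefl i a (h.trans i a b a h' h'')⟩
    · exact Or.inr ⟨h', fun h'' => h.irrefl i a (h.trans i a b a h'' h')⟩
  · rintro ⟨-, h⟩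
    refine ⟨fun i => (h i).2.1, fun i => (h i).2.2.1, fun i a b hab => ?_⟩
    exact ((h i).2.2.2 a b hab).imp And.left And.left

end MultiOrders

/-! ### A concrete Fraïssé limit. -/

section GenericGrid

variable {m : ℕ}

/-- The underlying set of a concrete generic multi-order. -/
def GenericGrid (m : ℕ) : Type := (Fin m → ℚ) × ℕ

instance : Countable (GenericGrid m) := inferInstanceAs (Countable ((Fin m → ℚ) × ℕ))

noncomputable instance : Encodable (GenericGrid m) :=
  inferInstanceAs (Encodable ((Fin m → ℚ) × ℕ))

/-- The `i`-th coordinate of a point: a rational number perturbed by an irrational shift that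
identifies the point. -/
noncomputable def coord (g : GenericGrid m) (i : Fin m) : ℝ :=
  g.1 i + √2 / (Encodable.encode g + 1)

/-- Distinct points have distinct rational multiples of `√2` as shifts, so a coincidence would make
`√2` rational. -/
theorem coord_injective (i : Fin m) : Function.Injective fun g : GenericGrid m => coord g i := by
  intro g h hgh
  simp only [coord] at hgh
  by_contra hne
  have hne' : Encodable.encode g ≠ Encodable.encode h := fun e =>
    hne (Encodable.encode_injective e)
  set a := Encodable.encode g
  set b := Encodable.encode h
  have ha : ((a : ℝ) + 1) ≠ 0 := by positivity
  have hb : ((b : ℝ) + 1) ≠ 0 := by positivity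
  have hab : ((b : ℝ) - a) ≠ 0 := by
    rw [sub_ne_zero]
    exact_mod_cast hne'.symm
  refine irrational_sqrt_two.ne_rat ((h.1 i - g.1 i) * (a + 1) * (b + 1) / (b - a)) ?_
  push_cast
  rw [eq_div_iff hab]
  field_simp at hgh
  linear_combination hgh

/-- Fix a rational point of the box; as the second component grows, the positive shift tends to `0`.
-/
theorem exists_coord_between (lo hi : Fin m → ℝ) (h : ∀ i, lo i < hi i) :
    ∃ g : GenericGrid m, ∀ i, lo i < coord g i ∧ coord g i < hi i := by
  choose p hp using fun i => exists_rat_btwn (h i)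
  have hinj : Function.Injective fun k : ℕ => Encodable.encode ((p, k) : GenericGrid m) :=
    fun k l hkl => (Prod.ext_iff.1 (Encodable.encode_injective hkl)).2
  have hlim : Filter.Tendsto (fun k : ℕ => √2 /
      ((Encodable.encode ((p, k) : GenericGrid m) : ℝ) + 1)) Filter.atTop (nhds 0) :=
    tendsto_const_nhds.div_atTop <| Filter.tendsto_atTop_add_const_right _ _ <|
      tendsto_natCast_atTop_atTop.comp hinj.nat_tendsto_atTop
  have hev : ∀ᶠ k : ℕ in Filter.atTop, ∀ i, √2 /
      ((Encodable.encode ((p, k) : GenericGrid m) : ℝ) + 1) < hi i - p i :=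
    Filter.eventually_all.2 fun i => hlim.eventually_lt_const (sub_pos.2 (hp i).2)
  obtain ⟨k, hk⟩ := hev.exists
  refine ⟨(p, k), fun i => ⟨(hp i).1.trans ?_, ?_⟩⟩
  · exact lt_add_of_pos_right _ (by positivity)
  · exact lt_sub_iff_add_lt'.1 (hk i)

noncomputable instance : (copies binLang m).Structure (GenericGrid m) :=
  ordStructure fun i a b => coord a i < coord b i

theorem isMultiOrder_genericGrid : IsMultiOrder m (GenericGrid m) :=
  isMultiOrder_of_coord coord coord_injective

theorem ordRel_genericGrid (i : Fin m) (a b : GenericGrid m) :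
    ordRel i a b ↔ coord a i < coord b i := Iff.rfl

/-- A new point is constrained on each axis only by finitely many lower and upper bounds. These
leave an open interval per axis, and every open box contains a point of the grid. -/
theorem isExtensionPair_genericGrid (hm : 0 < m) {N : Type} [(copies binLang m).Structure N]
    (hN : IsMultiOrder m N) : (copies binLang m).IsExtensionPair N (GenericGrid m) := by
  classical
  rw [isExtensionPair_iff_exists_embedding_closure_singleton_sup]
  intro S hS f x
  have hfin : Finite S := hS.finite
  cases nonempty_fintype S
  have hgen : ∃ γ : GenericGrid m, (∀ h : x ∈ S, γ = f ⟨x, h⟩) ∧ (∀ i (s : S),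
      (coord γ i < coord (f s) i ↔ ordRel i x s) ∧
      (coord (f s) i < coord γ i ↔ ordRel i (s : N) x)) := by
    by_cases hx : x ∈ S
    · exact ⟨f ⟨x, hx⟩, fun _ => rfl, fun i s =>
        ⟨(ordRel_map f i ⟨x, hx⟩ s).trans (ordRel_map S.subtype i ⟨x, hx⟩ s).symm,
          (ordRel_map f i s ⟨x, hx⟩).trans (ordRel_map S.subtype i s ⟨x, hx⟩).symm⟩⟩
    have hmid : ∀ i, ∃ u v : ℝ, u < v ∧ ∀ s : S, (ordRel i (s : N) x → coord (f s) i < u) ∧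
        (ordRel i x (s : N) → v < coord (f s) i) := by
      intro i
      set lo := (Finset.univ.filter fun s : S => ordRel i (s : N) x).image
        fun s => coord (f s) i with hlo
      set hi := (Finset.univ.filter fun s : S => ordRel i x (s : N)).image
        fun s => coord (f s) i with hhi
      have hlt : ∀ a ∈ lo, ∀ b ∈ hi, a < b := by
        simp only [hlo, hhi, Finset.mem_image, Finset.mem_filter, Finset.mem_univ, true_and]
        rintro _ ⟨s, hs, rfl⟩ _ ⟨t, ht, rfl⟩
        exact (ordRel_map f i s t).2 ((ordRel_map S.subtype i s t).1
          (hN.trans i _ _ _ hs ht))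
      obtain ⟨u, hu, hu'⟩ := Order.exists_between_finsets lo hi hlt
      obtain ⟨v, hv, hv'⟩ := Order.exists_between_finsets {u} hi (by simpa using hu')
      refine ⟨u, v, hv u (by simp), fun s => ⟨fun hs => hu _ ?_, fun hs => hv' _ ?_⟩⟩
      · exact Finset.mem_image_of_mem _ (by simpa using hs)
      · exact Finset.mem_image_of_mem _ (by simpa using hs)
    choose u v huv hmid using hmid
    obtain ⟨γ, hγ⟩ := exists_coord_between u v huv
    refine ⟨γ, fun h => absurd h hx, fun i s => ?_⟩
    have hne : (s : N) ≠ x := fun e => hx (e ▸ s.2)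
    rcases hN.total i s x hne with h | h
    · have h1 := ((hmid i s).1 h).trans (hγ i).1
      have h2 : ¬ ordRel i x s := fun h' => hN.irrefl i _ (hN.trans i _ _ _ h h')
      exact ⟨iff_of_false h1.not_gt h2, iff_of_true h1 h⟩
    · have h1 := (hγ i).2.trans ((hmid i s).2 h)
      have h2 : ¬ ordRel i (s : N) x := fun h' => hN.irrefl i _ (hN.trans i _ _ _ h h')
      exact ⟨iff_of_true h1 h, iff_of_false h1.not_gt h2⟩
  obtain ⟨γ, hγS, hγ⟩ := hgen
  have hmem : ∀ y ∈ (Substructure.closure (copies binLang m) {x} ⊔ S :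
      (copies binLang m).Substructure N), y ∉ S → y = x := by
    intro y hy hyS
    rw [← Substructure.closure_eq S, ← Substructure.closure_union,
      Substructure.mem_closure_iff_of_isRelational] at hy
    exact hy.resolve_right hyS
  let F : (Substructure.closure (copies binLang m) {x} ⊔ S :
      (copies binLang m).Substructure N) → GenericGrid m :=
    fun y => if h : (y : N) ∈ S then f ⟨y, h⟩ else γ
  have hF : ∀ (i : Fin m) a b, ordRel i (F a) (F b) ↔ ordRel i a b := by
    intro i a b
    rw [← ordRel_map (Substructure.subtype _) i a b, ordRel_genericGrid]
    by_cases ha : (a : N) ∈ S <;> by_cases hb : (b : N) ∈ S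
    · simp only [F, ha, hb, dif_pos]
      exact (ordRel_map f i ⟨a, ha⟩ ⟨b, hb⟩).trans (ordRel_map S.subtype i _ _).symm
    · simp only [F, ha, hb, dif_pos, dif_neg, not_false_eq_true]
      rw [(hγ i ⟨a, ha⟩).2]
      simp [hmem b b.2 hb]
    · simp only [F, ha, hb, dif_pos, dif_neg, not_false_eq_true]
      rw [(hγ i ⟨b, hb⟩).1]
      simp [hmem a a.2 ha]
    · simp only [F, ha, hb, dif_neg, not_false_eq_true]
      simp [hmem a a.2 ha, hmem b b.2 hb, hN.irrefl]
  refine ⟨multiOrderEmbedding hm (hN.of_embedding (Substructure.subtype _))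
    isMultiOrder_genericGrid F hF, Embedding.ext fun s => ?_⟩
  change f s = F _
  have hs : ((Substructure.inclusion le_sup_right s : (Substructure.closure (copies binLang m) {x} ⊔ S :
      (copies binLang m).Substructure N)) : N) ∈ S := s.2
  simp only [F, hs, dif_pos]
  rfl

/-- Each countable multi-order embeds into the generic one. -/
theorem nonempty_embedding_genericGrid (hm : 0 < m) {N : Type} [(copies binLang m).Structure N]
    [Countable N] (hN : IsMultiOrder m N) : Nonempty (N ↪[copies binLang m] GenericGrid m) :=
  let ⟨f, _⟩ := embedding_from_cg
    (Structure.cg_def.2 (Substructure.cg_iff_countable.2 inferInstance)) default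
    (isExtensionPair_genericGrid hm hN)
  ⟨f⟩

theorem isFraisseLimit_genericGrid (hm : 0 < m) :
    IsFraisseLimit (starPow LO m) (GenericGrid m) where
  ultrahomogeneous := (isUltrahomogeneous_iff_IsExtensionPair
    (Structure.cg_def.2 (Substructure.cg_iff_countable.2 inferInstance))).2
    (isExtensionPair_genericGrid hm isMultiOrder_genericGrid)
  age := by
    ext B
    constructor
    · rintro ⟨hfg, ⟨f⟩⟩
      have : Finite B := Structure.fg_iff_finite.1 hfg
      exact (isMultiOrder_iff_reduct B).1 (isMultiOrder_genericGrid.of_embedding f)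
    · intro hB
      have : Finite B := hB.1
      exact ⟨Structure.fg_iff_finite.2 this,
        nonempty_embedding_genericGrid hm ((isMultiOrder_iff_reduct B).2 hB)⟩

end GenericGrid

/-! ### Configurations versus patterns, and the two ranks. -/

section Comparison

variable {L : FirstOrder.Language.{u, v}} {M : Type w} [L.Structure M] {A : Set M} {d m : ℕ}
  {π : Set (L[[A]].Formula (Fin d))}

/-- An IRD-pattern of positive depth yields a configuration of the generic multi-order. -/
theorem HasIRDPattern.hasConfiguration {T : L.Theory} (hNIP : IsNIP.{u, v, w} T) [Nonempty M]
    [M ⊨ T] {κ : Cardinal.{w}} (hκ : ℵ_ 1 ≤ κ) (hM : IsSaturated L M κ) (hA : #A < κ)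
    (hm : 0 < m) (h : HasIRDPattern π m) : HasConfiguration (starPow LO m) π := by
  obtain ⟨b, hb, ε, hε, hφ⟩ := h.exists_grid hNIP hκ hM hA
  refine ⟨GenericGrid m, inferInstance, inferInstance, isFraisseLimit_genericGrid hm, ?_⟩
  -- Countable orders embed into the dense order `(-ε, ε)`. Doing this on each axis keeps distinct
  -- points distinct in every coordinate, as the order formulas require.
  have hemb : ∀ i : Fin m, ∃ e : GenericGrid m → ℚ, (∀ g, |e g| < ε) ∧
      ∀ g h, e g < e h ↔ coord g i < coord h i := by
    intro i
    have : Nontrivial (Set.Ioo (-ε) ε) :=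
      ⟨⟨0, by simpa using hε⟩, ⟨ε / 2, by constructor <;> linarith⟩,
        fun e => (half_pos hε).ne (congrArg Subtype.val e)⟩
    have : Countable (Set.range fun g : GenericGrid m => coord g i) :=
      (Set.countable_range _).to_subtype
    obtain ⟨e⟩ := Order.embedding_from_countable_to_dense
      (Set.range fun g : GenericGrid m => coord g i) (Set.Ioo (-ε) ε)
    refine ⟨fun g => e ⟨coord g i, g, rfl⟩, fun g => abs_lt.2 (e ⟨coord g i, g, rfl⟩).2,
      fun g h => ?_⟩
    rw [Subtype.coe_lt_coe, e.lt_iff_lt]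
    rfl
  choose e he hlt using hemb
  have hinj : ∀ i, Function.Injective (e i) := by
    intro i g h hgh
    refine coord_injective i (le_antisymm ?_ ?_)
    · exact not_lt.1 fun hl => ((hlt i h g).2 hl).ne hgh.symm
    · exact not_lt.1 fun hl => ((hlt i g h).2 hl).ne hgh
  refine ⟨fun g => b fun i => e i g, fun g => hb _, ?_⟩
  rintro _ ⟨i, ⟨⟩⟩
  obtain ⟨φ, hφ⟩ := hφ i
  refine ⟨φ, fun a => ?_⟩
  have key := hφ (fun i => e i (a 0)) (fun i => e i (a 1)) (fun i => he i _) (fun i => he i _) (by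
    by_cases h01 : a 0 = a 1
    · exact Or.inl (by rw [h01])
    · exact Or.inr fun i => (hinj i).ne h01)
  have hfun : (fun q : Fin 2 × Fin d => b (fun i => e i (a q.1)) q.2) =
      fun q => b (![fun i => e i (a 0), fun i => e i (a 1)] q.1) q.2 := by
    funext ⟨q, j⟩
    fin_cases q <;> rfl
  rw [hfun, key, hlt]
  exact (relMap_iff_ordRel i a).trans (ordRel_genericGrid i _ _)

/-- Positions of the points of an IRD-pattern of depth `m`, given by parameters `(i, j)` and
realizations `g`, in the `i`-th order. -/
def patternPos (x : (Fin m × ℕ) ⊕ (Fin m → ℕ)) (i : Fin m) : ℕ :=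
  x.elim (fun p => 2 * p.2) (fun g => 2 * g i + 1)

/-- A configuration of the generic multi-order yields an IRD-pattern. -/
theorem HasConfiguration.hasIRDPattern (hm : 0 < m)
    (h : HasConfiguration (starPow LO m) π) : HasIRDPattern π m := by
  obtain ⟨Γ, _, _, hΓ, f, hfπ, hf⟩ := h
  -- Parameters sit at even positions and realizations at odd ones, so `2 * g i + 1 < 2 * j` iff `g
  -- i < j`. The encoding breaks ties within each kind.
  let _ := ordStructure (m := m) fun i (x y : (Fin m × ℕ) ⊕ (Fin m → ℕ)) =>
    toLex (patternPos x i, Encodable.encode x) < toLex (patternPos y i, Encodable.encode y)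
  have hN : IsMultiOrder m ((Fin m × ℕ) ⊕ (Fin m → ℕ)) :=
    isMultiOrder_of_coord (fun x i => toLex (patternPos x i, Encodable.encode x))
      fun i x y hxy => Encodable.encode_injective (Prod.ext_iff.1 (toLex.injective hxy)).2
  obtain ⟨e⟩ := nonempty_embedding_genericGrid hm hN
  obtain ⟨E⟩ := (isFraisseLimit_genericGrid hm).nonempty_equiv hΓ
  let F := E.toEmbedding.comp e
  choose φ hφ using fun i : Fin m => hf 2 (ltSym i)
  refine ⟨fun _ => d, fun i => (φ i).relabel fun q => if q.1 = 0 then Sum.inl q.2 else Sum.inr q.2,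
    fun i j => f (F (Sum.inl (i, j))), fun g 𝓕 h𝓕 _ => ⟨f (F (Sum.inr g)), fun ψ hψ => ?_⟩⟩
  rcases h𝓕 hψ with ⟨χ, hχ, rfl⟩ | ⟨i, j, rfl⟩
  · exact (realize_onFormula_val χ _).2 (hfπ _ χ hχ)
  · rw [realize_formulaIff, realize_plugIn, Formula.realize_relabel]
    have hlt : ordRel i (F (Sum.inr g)) (F (Sum.inl (i, j))) ↔ g i < j := by
      rw [ordRel_map]
      refine (Prod.Lex.toLex_lt_toLex (x := (2 * g i + 1, _)) (y := (2 * j, _))).trans ?_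
      simp only
      omega
    rw [← hlt, ordRel, hφ]
    refine iff_of_eq (congrArg (φ i).Realize ?_)
    funext ⟨q, l⟩
    fin_cases q <;> rfl

theorem HasIRDPattern.mono {n : ℕ} (hnm : n ≤ m) (h : HasIRDPattern π m) :
    HasIRDPattern π n := by
  obtain ⟨k, φ, c, h⟩ := h
  refine ⟨fun i => k (Fin.castLE hnm i), fun i => φ (Fin.castLE hnm i),
    fun i => c (Fin.castLE hnm i), fun g F hF hfin => ?_⟩
  refine h (fun i => if hi : (i : ℕ) < n then g ⟨i, hi⟩ else 0) F (hF.trans ?_) hfin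
  refine Set.union_subset_union_right _ ?_
  rintro _ ⟨i, j, rfl⟩
  exact ⟨Fin.castLE hnm i, j, by simp⟩

theorem FinitelySatisfiable.liftParams (h : FinitelySatisfiable M π) :
    FinitelySatisfiable M (liftParams π) := by
  intro F hF hfin
  obtain ⟨F', hF', hfin', rfl⟩ := hfin.exists_subset_finite_image_eq hF
  obtain ⟨a, ha⟩ := h F' hF' hfin'
  refine ⟨a, ?_⟩
  rintro _ ⟨φ, hφ, rfl⟩
  exact (realize_onFormula_val φ a).2 (ha φ hφ)

theorem hasIRDPattern_zero (h : FinitelySatisfiable M π) : HasIRDPattern π 0 := by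
  refine ⟨fun i => i.elim0, fun i => i.elim0, fun i => i.elim0, fun g F hF hfin => ?_⟩
  refine h.liftParams F (fun ψ hψ => (hF hψ).resolve_right ?_) hfin
  rintro ⟨i, -⟩
  exact i.elim0

/-- Depths of patterns form an initial segment by `HasIRDPattern.mono`, so the supremum of the
depths attained agrees with the infimum of those `k` for which depth `k + 1` fails. Depth `0`,
outside the equivalence, is covered by `h0`. -/
theorem rank_eq_opDim (h0 : HasIRDPattern π 0)
    (h : ∀ n, 0 < n → (HasConfiguration (starPow LO n) π ↔ HasIRDPattern π n)) :
    rank LO π = opDim π := by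
  apply le_antisymm
  · refine ENat.forall_natCast_le_iff_le.1 fun n hn => ?_
    refine le_iSup₂_of_le n ?_ le_rfl
    rcases Nat.eq_zero_or_pos n with rfl | hpos
    · exact h0
    rw [← h n hpos]
    by_contra hc
    obtain ⟨k, rfl⟩ := Nat.exists_eq_add_of_le' hpos
    have : ((k + 1 : ℕ) : ℕ∞) ≤ k := hn.trans (iInf₂_le k hc)
    have : k + 1 ≤ k := by exact_mod_cast this
    omega
  · refine iSup₂_le fun n hn => le_iInf₂ fun k hk => ?_
    rw [h _ k.succ_pos] at hk
    by_contra hlt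
    have hlt' : k + 1 ≤ n := by
      have : ¬ n ≤ k := fun hle => hlt (by exact_mod_cast hle)
      omega
    exact hk (hn.mono hlt')

end Comparison

end KRank

/-- If `T` is a complete theory with NIP, then in a monster model of `T` the linear order rank of
each partial type over a small set equals its op-dimension. -/
theorem mainTheorem2 {L : FirstOrder.Language.{u, v}} (T : L.Theory) (hT : T.IsComplete)
    (hNIP : KRank.IsNIP.{u, v, w} T)
    (M : Type w) [L.Structure M] [Nonempty M] [M ⊨ T]
    (κ : Cardinal.{w}) (hκ : Cardinal.aleph 1 ≤ κ) (hM : KRank.IsSaturated L M κ)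
    (A : Set M) (hA : Cardinal.mk A < κ) (d : ℕ) (π : Set (L[[A]].Formula (Fin d)))
    (hπ : KRank.FinitelySatisfiable M π) :
    KRank.rank KRank.LO π = KRank.opDim π :=
  KRank.rank_eq_opDim (KRank.hasIRDPattern_zero hπ) fun _ hn =>
    ⟨fun h => h.hasIRDPattern hn, fun h => h.hasConfiguration hNIP hκ hM hA hn⟩
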